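/- Let $k$ be a field and $C$ a $k$-coalgebra, and let $C^*=\mathrm{Hom}_k(C,k)$ be its dual algebra, with product $(fg)(c)=\sum f(c_1)g(c_2)$ and unit $\varepsilon$. A left $C$-comodule $M$ with structure map $m\mapsto\sum m_{-1}\otimes m_0$ is a right $C^*$-module via $m\cdot f=\sum f(m_{-1})m_0$; in particular $C$ is a right $C^*$-module via $c\cdot f=\sum f(c_1)c_2$. For a right $C$-comodule $N$ with structure map $n\mapsto\sum n_0\otimes n_1$, the dual space $N^*$ is a right $C^*$-module via $(\alpha\cdot f)(n)=\sum\alpha(n_0)f(n_1)$. The coalgebra $C$ is called right co-Frobenius if there is an injective morphism of right $C^*$-modules $C\to C^*$. Let $C_0$ be the coradical of $C$ (the sum of all simple subcoalgebras of $C$), and let $C_0=\bigoplus_{i\in I}S_i$ and $C_0=\bigoplus_{j\in J}T_j$ be decompositions of $C_0$ as a direct sum of simple left $C$-subcomodules $S_i$ of $C$, respectively of simple right $C$-subcomodules $T_j$ of $C$. Let $E(S_i)$ denote an injective envelope of $S_i$ in the category of left $C$-comodules, and $E(T_j)$ an injective envelope of $T_j$ in the category of right $C$-comodules. Assume that $C$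 is right co-Frobenius. Then there exists an injective map $\phi:I\to J$ such that $E(S_i)\simeq E(T_{\phi(i)})^*$ as right $C^*$-modules for every $i\in I$. -/

import Mathlib

open TensorProduct

universe u v w

/-- The dual algebra `C* = Hom_k(C, k)` of a coalgebra, with the convolution product
`(f * g)(c) = ∑ f(c₁) g(c₂)` and unit `ε`. -/
abbrev DualAlg (k : Type u) (C : Type v) [Field k] [AddCommGroup C] [Module k C] :=
  WithConv (C →ₗ[k] k)

/-! ### Left comodules -/

/-- A left `C`-comodule structure `ρ : M → C ⊗ M`, `ρ(m) = ∑ m₋₁ ⊗ m₀`. -/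
class LeftComodule (k : Type u) (C : Type v) (M : Type w) [Field k] [AddCommGroup C] [Module k C]
    [Coalgebra k C] [AddCommGroup M] [Module k M] where
  coact : M →ₗ[k] C ⊗[k] M
  coassoc : (TensorProduct.assoc k C C M).toLinearMap ∘ₗ
      LinearMap.rTensor M (Coalgebra.comul (R := k) (A := C)) ∘ₗ coact =
    LinearMap.lTensor C coact ∘ₗ coact
  counit_coact : (TensorProduct.lid k M).toLinearMap ∘ₗ
      LinearMap.rTensor M (Coalgebra.counit (R := k) (A := C)) ∘ₗ coact = LinearMap.id

/-- A right `C`-comodule structure `ρ : M → M ⊗ C`, `ρ(m) = ∑ m₀ ⊗ m₁`. -/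
class RightComodule (k : Type u) (C : Type v) (M : Type w) [Field k] [AddCommGroup C] [Module k C]
    [Coalgebra k C] [AddCommGroup M] [Module k M] where
  coact : M →ₗ[k] M ⊗[k] C
  coassoc : (TensorProduct.assoc k M C C).toLinearMap ∘ₗ LinearMap.rTensor C coact ∘ₗ coact =
    LinearMap.lTensor M (Coalgebra.comul (R := k) (A := C)) ∘ₗ coact
  counit_coact : (TensorProduct.rid k M).toLinearMap ∘ₗ
      LinearMap.lTensor M (Coalgebra.counit (R := k) (A := C)) ∘ₗ coact = LinearMap.id

namespace LeftComodule

variable (k : Type u) (C : Type v) [Field k] [AddCommGroup C] [Module k C] [Coalgebra k C]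
variable {M : Type*} [AddCommGroup M] [Module k M] [LeftComodule k C M]
variable {N : Type*} [AddCommGroup N] [Module k N] [LeftComodule k C N]

/-- `C` as a left comodule over itself. -/
instance regular : LeftComodule k C C where
  coact := Coalgebra.comul
  coassoc := Coalgebra.coassoc
  counit_coact := by ext c; simp

/-- Morphisms of left comodules. -/
def IsHom (f : M →ₗ[k] N) : Prop :=
  LinearMap.lTensor C f ∘ₗ coact (k := k) (C := C) (M := M) = coact (k := k) (C := C) (M := N) ∘ₗ f

variable {k C} in
/-- The operator `m ↦ m · f = ∑ f(m₋₁) m₀` of `f ∈ C*`. -/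
def act (f : DualAlg k C) : M →ₗ[k] M :=
  (TensorProduct.lid k M).toLinearMap ∘ₗ LinearMap.rTensor M f.ofConv ∘ₗ
    coact (k := k) (C := C) (M := M)

lemma act_one : act (1 : DualAlg k C) = (LinearMap.id : M →ₗ[k] M) :=
  counit_coact (k := k) (C := C) (M := M)

lemma act_mul (f g : DualAlg k C) :
    (act (f * g) : M →ₗ[k] M) = act g ∘ₗ act f := by
  have key : (TensorProduct.lid k M).toLinearMap ∘ₗ LinearMap.rTensor M (f * g).ofConv =
      (TensorProduct.lid k M).toLinearMap ∘ₗ LinearMap.rTensor M g.ofConv ∘ₗ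
        (TensorProduct.lid k (C ⊗[k] M)).toLinearMap ∘ₗ LinearMap.rTensor (C ⊗[k] M) f.ofConv ∘ₗ
        (TensorProduct.assoc k C C M).toLinearMap ∘ₗ
        LinearMap.rTensor M (Coalgebra.comul (R := k) (A := C)) := by
    have aux : (TensorProduct.lid k M).toLinearMap ∘ₗ LinearMap.rTensor M
          (LinearMap.mul' k k ∘ₗ TensorProduct.map f.ofConv g.ofConv) =
        (TensorProduct.lid k M).toLinearMap ∘ₗ LinearMap.rTensor M g.ofConv ∘ₗ
        (TensorProduct.lid k (C ⊗[k] M)).toLinearMap ∘ₗ LinearMap.rTensor (C ⊗[k] M) f.ofConv ∘ₗ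
        (TensorProduct.assoc k C C M).toLinearMap := by
      ext a b m
      simp [mul_smul]
    have h2 : (f * g).ofConv = (LinearMap.mul' k k ∘ₗ TensorProduct.map f.ofConv g.ofConv) ∘ₗ
      Coalgebra.comul := rfl
    rw [h2, LinearMap.rTensor_comp, ← LinearMap.comp_assoc, aux]
    rfl
  have nat : (TensorProduct.lid k (C ⊗[k] M)).toLinearMap ∘ₗ
        LinearMap.rTensor (C ⊗[k] M) f.ofConv ∘ₗ LinearMap.lTensor C (coact (k := k) (M := M)) =
      coact (k := k) (C := C) (M := M) ∘ₗ
        (TensorProduct.lid k M).toLinearMap ∘ₗ LinearMap.rTensor M f.ofConv := by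
    ext a m
    simp
  ext m
  have h1 := LinearMap.congr_fun key (coact (k := k) m)
  have h2 := LinearMap.congr_fun (coassoc (k := k) (C := C) (M := M)) m
  have h3 := LinearMap.congr_fun nat (coact (k := k) m)
  simp only [LinearMap.comp_apply, LinearEquiv.coe_coe, act] at h1 h2 h3 ⊢
  rw [h1, h2, h3]

/-- A left `C`-comodule is a right `C*`-module via `m · f = ∑ f(m₋₁) m₀`. -/
instance module : Module (DualAlg k C)ᵐᵒᵖ M where
  smul f m := act f.unop m
  one_smul m := LinearMap.congr_fun (act_one k C) m
  mul_smul f g m := LinearMap.congr_fun (act_mul k C g.unop f.unop) m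
  smul_zero f := map_zero _
  smul_add f := map_add _
  add_smul f g m := by
    change act (f.unop + g.unop) m = act f.unop m + act g.unop m
    simp [act, LinearMap.rTensor_add]
  zero_smul m := by
    change act (0 : DualAlg k C) m = 0
    simp [act]

lemma op_smul_def (f : DualAlg k C) (m : M) : MulOpposite.op f • m = act f m := rfl

end LeftComodule

namespace RightComodule

variable (k : Type u) (C : Type v) [Field k] [AddCommGroup C] [Module k C] [Coalgebra k C]
variable {M : Type*} [AddCommGroup M] [Module k M] [RightComodule k C M]
variable {N : Type*} [AddCommGroup N] [Module k N] [RightComodule k C N]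

/-- `C` as a right comodule over itself. -/
instance regular : RightComodule k C C where
  coact := Coalgebra.comul
  coassoc := Coalgebra.coassoc
  counit_coact := by ext c; simp

/-- Morphisms of right comodules. -/
def IsHom (f : M →ₗ[k] N) : Prop :=
  LinearMap.rTensor C f ∘ₗ coact (k := k) (C := C) (M := M) = coact (k := k) (C := C) (M := N) ∘ₗ f

variable {k C} in
/-- The operator `m ↦ f · m = ∑ f(m₁) m₀` of `f ∈ C*`; it makes `M` a left `C*`-module. -/
def act (f : DualAlg k C) : M →ₗ[k] M :=
  (TensorProduct.rid k M).toLinearMap ∘ₗ LinearMap.lTensor M f.ofConv ∘ₗ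
    coact (k := k) (C := C) (M := M)

lemma act_one : act (1 : DualAlg k C) = (LinearMap.id : M →ₗ[k] M) :=
  counit_coact (k := k) (C := C) (M := M)

lemma act_mul (f g : DualAlg k C) :
    (act (f * g) : M →ₗ[k] M) = act f ∘ₗ act g := by
  have aux : (TensorProduct.rid k M).toLinearMap ∘ₗ LinearMap.lTensor M
        (LinearMap.mul' k k ∘ₗ TensorProduct.map f.ofConv g.ofConv) ∘ₗ
        (TensorProduct.assoc k M C C).toLinearMap =
      (TensorProduct.rid k M).toLinearMap ∘ₗ LinearMap.lTensor M f.ofConv ∘ₗ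
      (TensorProduct.rid k (M ⊗[k] C)).toLinearMap ∘ₗ LinearMap.lTensor (M ⊗[k] C) g.ofConv := by
    ext m a b
    simp [smul_smul, mul_comm]
  have nat : (TensorProduct.rid k (M ⊗[k] C)).toLinearMap ∘ₗ
        LinearMap.lTensor (M ⊗[k] C) g.ofConv ∘ₗ LinearMap.rTensor C (coact (k := k) (M := M)) =
      coact (k := k) (C := C) (M := M) ∘ₗ
        (TensorProduct.rid k M).toLinearMap ∘ₗ LinearMap.lTensor M g.ofConv := by
    ext m a
    simp
  have hfg : (f * g).ofConv = (LinearMap.mul' k k ∘ₗ TensorProduct.map f.ofConv g.ofConv) ∘ₗ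
      Coalgebra.comul := rfl
  ext m
  have h1 := LinearMap.congr_fun aux
    (LinearMap.rTensor C (coact (k := k) (C := C) (M := M)) (coact (k := k) m))
  have h2 := LinearMap.congr_fun (coassoc (k := k) (C := C) (M := M)) m
  have h3 := LinearMap.congr_fun nat (coact (k := k) m)
  simp only [LinearMap.comp_apply, LinearEquiv.coe_coe, act] at h1 h2 h3 ⊢
  rw [h2, h3] at h1
  rw [hfg, LinearMap.lTensor_comp]
  exact h1

/-- The dual `M* = Hom_k(M, k)` of a right `C`-comodule is a right `C*`-module via
`(α · f)(m) = α(f · m) = ∑ α(m₀) f(m₁)`. -/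
instance dualModule : Module (DualAlg k C)ᵐᵒᵖ (M →ₗ[k] k) where
  smul f α := α ∘ₗ act f.unop
  one_smul α := by
    change α ∘ₗ act (1 : DualAlg k C) = α
    rw [act_one]; rfl
  mul_smul f g α := by
    change α ∘ₗ act (g.unop * f.unop) = (α ∘ₗ act g.unop) ∘ₗ act f.unop
    rw [act_mul]; rfl
  smul_zero f := LinearMap.zero_comp _
  smul_add f α β := LinearMap.add_comp _ _ _
  add_smul f g α := by
    change α ∘ₗ act (f.unop + g.unop) = α ∘ₗ act f.unop + α ∘ₗ act g.unop
    ext m; simp [act, LinearMap.lTensor_add]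
  zero_smul α := by
    change α ∘ₗ act (0 : DualAlg k C) = 0
    ext m; simp [act]

lemma op_smul_dual_apply (f : DualAlg k C) (α : M →ₗ[k] k) (m : M) :
    (MulOpposite.op f • α) m = α (act f m) := rfl

end RightComodule

/-! ### Subcomodules -/

lemma lTensor_subtype_injective {k : Type*} [Field k] (C : Type*) [AddCommGroup C] [Module k C]
    {M : Type*} [AddCommGroup M] [Module k M] (N : Submodule k M) :
    Function.Injective (LinearMap.lTensor C N.subtype) :=
  Module.Flat.lTensor_preserves_injective_linearMap _ N.injective_subtype

lemma rTensor_subtype_injective {k : Type*} [Field k] (C : Type*) [AddCommGroup C] [Module k C]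
    {M : Type*} [AddCommGroup M] [Module k M] (N : Submodule k M) :
    Function.Injective (LinearMap.rTensor C N.subtype) :=
  Module.Flat.rTensor_preserves_injective_linearMap _ N.injective_subtype

/-- A subspace `N ≤ M` with `ρ(N) ⊆ C ⊗ N`. -/
structure LeftSubcomodule (k : Type u) (C : Type v) (M : Type w) [Field k] [AddCommGroup C]
    [Module k C] [Coalgebra k C] [AddCommGroup M] [Module k M] [LeftComodule k C M]
    extends Submodule k M where
  coact_mem : ∀ m ∈ toSubmodule, LeftComodule.coact (k := k) (C := C) m ∈
    LinearMap.range (LinearMap.lTensor C toSubmodule.subtype)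

/-- A subspace `N ≤ M` with `ρ(N) ⊆ N ⊗ C`. -/
structure RightSubcomodule (k : Type u) (C : Type v) (M : Type w) [Field k] [AddCommGroup C]
    [Module k C] [Coalgebra k C] [AddCommGroup M] [Module k M] [RightComodule k C M]
    extends Submodule k M where
  coact_mem : ∀ m ∈ toSubmodule, RightComodule.coact (k := k) (C := C) m ∈
    LinearMap.range (LinearMap.rTensor C toSubmodule.subtype)

namespace LeftSubcomodule

variable {k : Type u} {C : Type v} [Field k] [AddCommGroup C] [Module k C] [Coalgebra k C]
variable {M : Type*} [AddCommGroup M] [Module k M] [LeftComodule k C M]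

/-- The restriction `N → C ⊗ N` of the coaction of `M`. -/
noncomputable def coact (N : LeftSubcomodule k C M) :
    N.toSubmodule →ₗ[k] C ⊗[k] N.toSubmodule :=
  (LinearEquiv.ofInjective _ (lTensor_subtype_injective C N.toSubmodule)).symm.toLinearMap ∘ₗ
    LinearMap.codRestrict _ (LeftComodule.coact (k := k) (C := C) ∘ₗ N.toSubmodule.subtype)
      (fun m => N.coact_mem m m.2)

lemma lTensor_coact (N : LeftSubcomodule k C M) :
    LinearMap.lTensor C N.toSubmodule.subtype ∘ₗ N.coact =
      LeftComodule.coact (k := k) (C := C) ∘ₗ N.toSubmodule.subtype := by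
  ext m
  have h := LinearEquiv.apply_symm_apply
    (LinearEquiv.ofInjective _ (lTensor_subtype_injective C N.toSubmodule))
    (LinearMap.codRestrict _ (LeftComodule.coact (k := k) (C := C) ∘ₗ N.toSubmodule.subtype)
      (fun m => N.coact_mem m m.2) m)
  exact congrArg Subtype.val h

/-- A subcomodule is a comodule. -/
noncomputable instance leftComodule (N : LeftSubcomodule k C M) :
    LeftComodule k C N.toSubmodule where
  coact := N.coact
  coassoc := by
    have inj : Function.Injective
        (LinearMap.lTensor C (LinearMap.lTensor C N.toSubmodule.subtype)) :=
      Module.Flat.lTensor_preserves_injective_linearMap _ (lTensor_subtype_injective C _)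
    have e := lTensor_coact N
    have h := LeftComodule.coassoc (k := k) (C := C) (M := M)
    have n1 : LinearMap.lTensor C (LinearMap.lTensor C N.toSubmodule.subtype) ∘ₗ
        (TensorProduct.assoc k C C N.toSubmodule).toLinearMap ∘ₗ
          LinearMap.rTensor N.toSubmodule (Coalgebra.comul (R := k) (A := C)) =
        (TensorProduct.assoc k C C M).toLinearMap ∘ₗ
          LinearMap.rTensor M (Coalgebra.comul (R := k) (A := C)) ∘ₗ
          LinearMap.lTensor C N.toSubmodule.subtype := by
      have a : LinearMap.lTensor C (LinearMap.lTensor C N.toSubmodule.subtype) ∘ₗ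
          (TensorProduct.assoc k C C N.toSubmodule).toLinearMap =
          (TensorProduct.assoc k C C M).toLinearMap ∘ₗ
            LinearMap.lTensor (C ⊗[k] C) N.toSubmodule.subtype := by
        ext a b m; simp
      rw [← LinearMap.comp_assoc, a, LinearMap.comp_assoc, LinearMap.lTensor_comp_rTensor,
        LinearMap.rTensor_comp_lTensor]
    rw [← LinearMap.cancel_left inj]
    have n2 : LinearMap.lTensor C (LinearMap.lTensor C N.toSubmodule.subtype) ∘ₗ
        LinearMap.lTensor C N.coact =
        LinearMap.lTensor C (LeftComodule.coact (k := k) (C := C) (M := M)) ∘ₗ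
          LinearMap.lTensor C N.toSubmodule.subtype := by
      rw [← LinearMap.lTensor_comp, e, LinearMap.lTensor_comp]
    ext1 m
    have e' := LinearMap.congr_fun e m
    have h' := LinearMap.congr_fun h m
    have n1' := LinearMap.congr_fun n1 (N.coact m)
    have n2' := LinearMap.congr_fun n2 (N.coact m)
    simp only [LinearMap.comp_apply, LinearEquiv.coe_coe, Submodule.subtype_apply]
      at e' h' n1' n2' ⊢
    rw [n1', n2', e', h']
  counit_coact := by
    rw [← LinearMap.cancel_left N.toSubmodule.injective_subtype]
    have n1 : N.toSubmodule.subtype ∘ₗ (TensorProduct.lid k N.toSubmodule).toLinearMap ∘ₗ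
        LinearMap.rTensor N.toSubmodule (Coalgebra.counit (R := k) (A := C)) =
        (TensorProduct.lid k M).toLinearMap ∘ₗ
          LinearMap.rTensor M (Coalgebra.counit (R := k) (A := C)) ∘ₗ
          LinearMap.lTensor C N.toSubmodule.subtype := by
      ext a m; simp
    ext1 m
    have e' := LinearMap.congr_fun (lTensor_coact N) m
    have h' := LinearMap.congr_fun (LeftComodule.counit_coact (k := k) (C := C) (M := M)) m
    have n1' := LinearMap.congr_fun n1 (N.coact m)
    simp only [LinearMap.comp_apply, LinearEquiv.coe_coe, Submodule.subtype_apply]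
      at e' h' n1' ⊢
    rw [n1', e', h']
    rfl

end LeftSubcomodule

namespace RightSubcomodule

variable {k : Type u} {C : Type v} [Field k] [AddCommGroup C] [Module k C] [Coalgebra k C]
variable {M : Type*} [AddCommGroup M] [Module k M] [RightComodule k C M]

/-- The restriction `N → N ⊗ C` of the coaction of `M`. -/
noncomputable def coact (N : RightSubcomodule k C M) :
    N.toSubmodule →ₗ[k] N.toSubmodule ⊗[k] C :=
  (LinearEquiv.ofInjective _ (rTensor_subtype_injective C N.toSubmodule)).symm.toLinearMap ∘ₗ
    LinearMap.codRestrict _ (RightComodule.coact (k := k) (C := C) ∘ₗ N.toSubmodule.subtype)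
      (fun m => N.coact_mem m m.2)

lemma rTensor_coact (N : RightSubcomodule k C M) :
    LinearMap.rTensor C N.toSubmodule.subtype ∘ₗ N.coact =
      RightComodule.coact (k := k) (C := C) ∘ₗ N.toSubmodule.subtype := by
  ext m
  have h := LinearEquiv.apply_symm_apply
    (LinearEquiv.ofInjective _ (rTensor_subtype_injective C N.toSubmodule))
    (LinearMap.codRestrict _ (RightComodule.coact (k := k) (C := C) ∘ₗ N.toSubmodule.subtype)
      (fun m => N.coact_mem m m.2) m)
  exact congrArg Subtype.val h

/-- A subcomodule is a comodule. -/
noncomputable instance rightComodule (N : RightSubcomodule k C M) :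
    RightComodule k C N.toSubmodule where
  coact := N.coact
  coassoc := by
    have inj : Function.Injective (LinearMap.rTensor (C ⊗[k] C) N.toSubmodule.subtype) :=
      rTensor_subtype_injective _ _
    have e := rTensor_coact N
    have h := RightComodule.coassoc (k := k) (C := C) (M := M)
    have n1 : LinearMap.rTensor (C ⊗[k] C) N.toSubmodule.subtype ∘ₗ
        LinearMap.lTensor N.toSubmodule (Coalgebra.comul (R := k) (A := C)) =
        LinearMap.lTensor M (Coalgebra.comul (R := k) (A := C)) ∘ₗ
          LinearMap.rTensor C N.toSubmodule.subtype := by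
      rw [LinearMap.lTensor_comp_rTensor, LinearMap.rTensor_comp_lTensor]
    have n2 : LinearMap.rTensor (C ⊗[k] C) N.toSubmodule.subtype ∘ₗ
        (TensorProduct.assoc k N.toSubmodule C C).toLinearMap ∘ₗ LinearMap.rTensor C N.coact =
        (TensorProduct.assoc k M C C).toLinearMap ∘ₗ
          LinearMap.rTensor C (RightComodule.coact (k := k) (C := C) (M := M)) ∘ₗ
          LinearMap.rTensor C N.toSubmodule.subtype := by
      have a : LinearMap.rTensor (C ⊗[k] C) N.toSubmodule.subtype ∘ₗ
          (TensorProduct.assoc k N.toSubmodule C C).toLinearMap =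
          (TensorProduct.assoc k M C C).toLinearMap ∘ₗ
            LinearMap.rTensor C (LinearMap.rTensor C N.toSubmodule.subtype) := by
        ext m a b; simp
      rw [← LinearMap.comp_assoc, a, LinearMap.comp_assoc, ← LinearMap.rTensor_comp, e,
        LinearMap.rTensor_comp]
    rw [← LinearMap.cancel_left inj]
    ext1 m
    have e' := LinearMap.congr_fun e m
    have h' := LinearMap.congr_fun h m
    have n1' := LinearMap.congr_fun n1 (N.coact m)
    have n2' := LinearMap.congr_fun n2 (N.coact m)
    simp only [LinearMap.comp_apply, LinearEquiv.coe_coe, Submodule.subtype_apply]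
      at e' h' n1' n2' ⊢
    rw [n1', n2', e', h']
  counit_coact := by
    rw [← LinearMap.cancel_left N.toSubmodule.injective_subtype]
    have n1 : N.toSubmodule.subtype ∘ₗ (TensorProduct.rid k N.toSubmodule).toLinearMap ∘ₗ
        LinearMap.lTensor N.toSubmodule (Coalgebra.counit (R := k) (A := C)) =
        (TensorProduct.rid k M).toLinearMap ∘ₗ
          LinearMap.lTensor M (Coalgebra.counit (R := k) (A := C)) ∘ₗ
          LinearMap.rTensor C N.toSubmodule.subtype := by
      ext m a; simp
    ext1 m
    have e' := LinearMap.congr_fun (rTensor_coact N) m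
    have h' := LinearMap.congr_fun (RightComodule.counit_coact (k := k) (C := C) (M := M)) m
    have n1' := LinearMap.congr_fun n1 (N.coact m)
    simp only [LinearMap.comp_apply, LinearEquiv.coe_coe, Submodule.subtype_apply]
      at e' h' n1' ⊢
    rw [n1', e', h']
    rfl

end RightSubcomodule

/-! ### Simple comodules, injective comodules, injective envelopes -/

namespace LeftComodule

variable (k : Type u) (C : Type v) [Field k] [AddCommGroup C] [Module k C] [Coalgebra k C]

/-- A simple left comodule: nonzero, with no subcomodules but `0` and itself. -/
def IsSimple (M : Type w) [AddCommGroup M] [Module k M] [LeftComodule k C M] : Prop :=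
  Nontrivial M ∧ ∀ N : LeftSubcomodule k C M, N.toSubmodule = ⊥ ∨ N.toSubmodule = ⊤

/-- An injective object of the category of left `C`-comodules (whose monomorphisms are the
injective comodule maps). -/
def IsInjective (E : Type v) [AddCommGroup E] [Module k E] [LeftComodule k C E] : Prop :=
  ∀ (X Y : Type v) [AddCommGroup X] [Module k X] [LeftComodule k C X]
    [AddCommGroup Y] [Module k Y] [LeftComodule k C Y] (f : X →ₗ[k] Y) (g : X →ₗ[k] E),
    IsHom k C f → Function.Injective f → IsHom k C g →
    ∃ h : Y →ₗ[k] E, IsHom k C h ∧ h ∘ₗ f = g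

/-- `ι : S → E` is an injective envelope of the left comodule `S`: `E` is an injective comodule
and `ι` is an essential monomorphism of comodules. -/
structure IsInjectiveEnvelope {S E : Type v} [AddCommGroup S] [Module k S] [LeftComodule k C S]
    [AddCommGroup E] [Module k E] [LeftComodule k C E] (ι : S →ₗ[k] E) : Prop where
  isHom : IsHom k C ι
  injective : Function.Injective ι
  essential : ∀ N : LeftSubcomodule k C E,
    N.toSubmodule ⊓ LinearMap.range ι = ⊥ → N.toSubmodule = ⊥
  isInjective : IsInjective k C E

end LeftComodule

namespace RightComodule

variable (k : Type u) (C : Type v) [Field k] [AddCommGroup C] [Module k C] [Coalgebra k C]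

/-- A simple right comodule: nonzero, with no subcomodules but `0` and itself. -/
def IsSimple (M : Type w) [AddCommGroup M] [Module k M] [RightComodule k C M] : Prop :=
  Nontrivial M ∧ ∀ N : RightSubcomodule k C M, N.toSubmodule = ⊥ ∨ N.toSubmodule = ⊤

/-- An injective object of the category of right `C`-comodules (whose monomorphisms are the
injective comodule maps). -/
def IsInjective (E : Type v) [AddCommGroup E] [Module k E] [RightComodule k C E] : Prop :=
  ∀ (X Y : Type v) [AddCommGroup X] [Module k X] [RightComodule k C X]
    [AddCommGroup Y] [Module k Y] [RightComodule k C Y] (f : X →ₗ[k] Y) (g : X →ₗ[k] E),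
    IsHom k C f → Function.Injective f → IsHom k C g →
    ∃ h : Y →ₗ[k] E, IsHom k C h ∧ h ∘ₗ f = g

/-- `ι : T → E` is an injective envelope of the right comodule `T`: `E` is an injective comodule
and `ι` is an essential monomorphism of comodules. -/
structure IsInjectiveEnvelope {T E : Type v} [AddCommGroup T] [Module k T] [RightComodule k C T]
    [AddCommGroup E] [Module k E] [RightComodule k C E] (ι : T →ₗ[k] E) : Prop where
  isHom : IsHom k C ι
  injective : Function.Injective ι
  essential : ∀ N : RightSubcomodule k C E,
    N.toSubmodule ⊓ LinearMap.range ι = ⊥ → N.toSubmodule = ⊥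
  isInjective : IsInjective k C E

end RightComodule

/-! ### The coradical and the co-Frobenius property -/

section Coalgebra

variable (k : Type u) (C : Type v) [Field k] [AddCommGroup C] [Module k C] [Coalgebra k C]

variable {C} in
/-- A subcoalgebra: a subspace `D ≤ C` with `Δ(D) ⊆ D ⊗ D`. -/
def IsSubcoalgebra (D : Submodule k C) : Prop :=
  ∀ d ∈ D, Coalgebra.comul (R := k) d ∈ LinearMap.range (TensorProduct.mapIncl D D)

variable {C} in
/-- A simple subcoalgebra: nonzero, containing no subcoalgebras but `0` and itself. -/
def IsSimpleSubcoalgebra (D : Submodule k C) : Prop :=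
  IsSubcoalgebra k D ∧ D ≠ ⊥ ∧ ∀ D' ≤ D, IsSubcoalgebra k D' → D' = ⊥ ∨ D' = D

/-- The coradical `C₀`: the sum of all simple subcoalgebras. -/
def coradical : Submodule k C :=
  sSup {D : Submodule k C | IsSimpleSubcoalgebra k D}

/-- `C` is right co-Frobenius if it embeds in `C*` as a right `C*`-module, where
`c · f = ∑ f(c₁) c₂` for `c ∈ C`, and `C*` acts on itself by right multiplication. -/
def IsRightCoFrobenius : Prop :=
  ∃ θ : C →ₗ[k] DualAlg k C, Function.Injective θ ∧
    ∀ (c : C) (f : DualAlg k C), θ (MulOpposite.op f • c) = θ c * f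

/-- `C₀ = ⊕ᵢ Sᵢ`, a direct sum of simple left subcomodules of `C`. -/
structure IsLeftCoradicalDecomposition {I : Type*} (S : I → LeftSubcomodule k C C) : Prop where
  isSimple : ∀ i, LeftComodule.IsSimple k C (S i).toSubmodule
  independent : iSupIndep fun i => (S i).toSubmodule
  iSup_eq : ⨆ i, (S i).toSubmodule = coradical k C

/-- `C₀ = ⊕ⱼ Tⱼ`, a direct sum of simple right subcomodules of `C`. -/
structure IsRightCoradicalDecomposition {J : Type*} (T : J → RightSubcomodule k C C) : Prop where
  isSimple : ∀ j, RightComodule.IsSimple k C (T j).toSubmodule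
  independent : iSupIndep fun j => (T j).toSubmodule
  iSup_eq : ⨆ j, (T j).toSubmodule = coradical k C

end Coalgebra

/-! A comodule over `C` is a `C*`-module all of whose orbits are finite-dimensional over `k`;
comodule maps and subcomodules are the `C*`-linear maps and the stable subspaces. Hence the argument
is module theory over `C*`.

Embed each E(S_i) in `C` as a direct summand, by `u i` with retraction `p i`, and write the right
comodule `C` as the direct sum of the E(T_j), by the maps `v j` (`RightComodule.bijective_lsum`).
The embedding θ : C → C* then breaks into balanced pairings (m, y) ↦ θ(u m)(v y) on E(S_i) × E(T_j).
Call i and j linked if this pairing is nonzero on S_i. Essentiality on both sides, together with the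
retraction `p i`, makes the pairing of a linked pair perfect (`bijective_of_balanced`), so E(S_i) ≃
E(T_j)*.

What remains is to choose linked partners injectively, which is Hall's marriage theorem. Each i has
finitely many partners, because they yield linearly independent vectors in the finite-dimensional
E(S_i) (`finite_setOf_exists_counit`). Hall's inequality is a comparison of lengths: if G is the set
of partners of a finite set F, then θ embeds the sum of the S_i, i ∈ F, in the product of the
E(T_j)*, j ∈ G. Each of these duals is some E(S_a), with simple socle, so |F| ≤ |G|
(`card_le_card_of_linked`). -/

/-! ### Functionals separate tensors -/

section Separation

variable {k : Type*} [Field k] {C M : Type*} [AddCommGroup C] [Module k C]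
  [AddCommGroup M] [Module k M]

/-- A basis of `C` identifies C ⊗ M with finitely supported families in `M`, and the members of such
a family are the slices by coordinate functionals. -/
lemma eq_zero_of_forall_lid_rTensor {x : C ⊗[k] M}
    (h : ∀ f : C →ₗ[k] k, TensorProduct.lid k M (LinearMap.rTensor M f x) = 0) : x = 0 := by
  classical
  let b := Module.Basis.ofVectorSpace k C
  apply (TensorProduct.equivFinsuppOfBasisLeft (N := M) b).injective
  rw [map_zero]
  ext i
  have key : ∀ y : C ⊗[k] M, TensorProduct.equivFinsuppOfBasisLeft (N := M) b y i =
      TensorProduct.lid k M (LinearMap.rTensor M (b.coord i) y) := by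
    intro y
    induction y with
    | zero => simp
    | add y z hy hz => simp [hy, hz]
    | tmul c m => simp
  rw [key, h, Finsupp.zero_apply]

lemma eq_zero_of_forall_rid_lTensor {x : M ⊗[k] C}
    (h : ∀ f : C →ₗ[k] k, TensorProduct.rid k M (LinearMap.lTensor M f x) = 0) : x = 0 := by
  classical
  let b := Module.Basis.ofVectorSpace k C
  apply (TensorProduct.equivFinsuppOfBasisRight (M := M) b).injective
  rw [map_zero]
  ext i
  have key : ∀ y : M ⊗[k] C, TensorProduct.equivFinsuppOfBasisRight (M := M) b y i =
      TensorProduct.rid k M (LinearMap.lTensor M (b.coord i) y) := by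
    intro y
    induction y with
    | zero => simp
    | add y z hy hz => simp [hy, hz]
    | tmul c m => simp
  rw [key, h, Finsupp.zero_apply]

/-- With a projection onto `N` viewed as an endomorphism of `M`, membership of a tensor in C ⊗ N
becomes a fixed-point equation, which functionals can test. -/
lemma exists_idempotent_of_submodule (N : Submodule k M) :
    ∃ P : M →ₗ[k] M, (∀ m, P m ∈ N) ∧ ∀ m ∈ N, P m = m := by
  obtain ⟨p, hp⟩ := N.subtype.exists_leftInverse_of_injective N.ker_subtype
  refine ⟨N.subtype ∘ₗ p, fun m => (p m).2, fun m hm => ?_⟩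
  exact congrArg Subtype.val (LinearMap.congr_fun hp ⟨m, hm⟩)

end Separation

/-! ### Left comodules as right C*-modules -/

namespace LeftComodule

variable {k : Type u} {C : Type v} [Field k] [AddCommGroup C] [Module k C] [Coalgebra k C]
variable {M : Type*} [AddCommGroup M] [Module k M] [LeftComodule k C M]
variable {N : Type*} [AddCommGroup N] [Module k N] [LeftComodule k C N]

lemma act_apply (f : DualAlg k C) (m : M) : act f m =
    TensorProduct.lid k M (LinearMap.rTensor M f.ofConv (coact (k := k) (C := C) m)) := rfl

/-- Slicing the comodule identity by functionals on `C` loses nothing, since functionals separate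
tensors. -/
lemma isHom_iff (g : M →ₗ[k] N) :
    IsHom k C g ↔ ∀ (f : DualAlg k C) (m : M), g (act f m) = act f (g m) := by
  have nat : ∀ (f : C →ₗ[k] k) (x : C ⊗[k] M),
      g (TensorProduct.lid k M (LinearMap.rTensor M f x)) =
        TensorProduct.lid k N (LinearMap.rTensor N f (LinearMap.lTensor C g x)) := by
    intro f x
    induction x with
    | zero => simp
    | add y z hy hz => simp [hy, hz]
    | tmul c m => simp
  constructor
  · intro h f m
    have := LinearMap.congr_fun h m
    simp only [LinearMap.comp_apply] at this
    rw [act_apply, act_apply, nat, this]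
  · intro h
    ext m
    rw [← sub_eq_zero]
    apply eq_zero_of_forall_lid_rTensor
    intro f
    have := h (WithConv.toConv f) m
    rw [act_apply, act_apply, nat] at this
    simpa [sub_eq_zero] using this

/-- A subspace stable under the operators of `C*` is a subcomodule. -/
def subcomoduleOfStable (Q : Submodule k M) (h : ∀ (f : DualAlg k C), ∀ m ∈ Q, act f m ∈ Q) :
    LeftSubcomodule k C M where
  toSubmodule := Q
  coact_mem m hm := by
    obtain ⟨P, hP, hPQ⟩ := exists_idempotent_of_submodule Q
    have key : LinearMap.lTensor C P (coact (k := k) (C := C) m) = coact (k := k) (C := C) m := by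
      rw [← sub_eq_zero]
      apply eq_zero_of_forall_lid_rTensor
      intro f
      have nat : ∀ x : C ⊗[k] M,
          TensorProduct.lid k M (LinearMap.rTensor M f (LinearMap.lTensor C P x)) =
          P (TensorProduct.lid k M (LinearMap.rTensor M f x)) := by
        intro x
        induction x with
        | zero => simp
        | add y z hy hz => simp [hy, hz]
        | tmul c m => simp
      rw [map_sub, map_sub, nat]
      have := hPQ _ (h (WithConv.toConv f) m hm)
      rw [act_apply] at this
      exact sub_eq_zero.2 this
    rw [← key]
    have e : P = Q.subtype ∘ₗ P.codRestrict Q hP := rfl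
    rw [e, LinearMap.lTensor_comp]
    exact ⟨_, rfl⟩

lemma coe_act (f : DualAlg k C) (Q : LeftSubcomodule k C M) (m : Q.toSubmodule) :
    ((act f m : Q.toSubmodule) : M) = act f (m : M) :=
  (isHom_iff (C := C) Q.toSubmodule.subtype).1 (LeftSubcomodule.lTensor_coact Q) f m

instance : IsScalarTower k (DualAlg k C)ᵐᵒᵖ M where
  smul_assoc a f m := by
    change act (a • f.unop) m = a • act f.unop m
    simp [act, LinearMap.rTensor_smul]

lemma act_mul_apply (f g : DualAlg k C) (m : M) : act (f * g) m = act g (act f m) :=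
  LinearMap.congr_fun (act_mul k C f g) m

lemma IsInjectiveEnvelope.eq_bot_of_stable {S E : Type v} [AddCommGroup S] [Module k S]
    [LeftComodule k C S] [AddCommGroup E] [Module k E] [LeftComodule k C E] {ι : S →ₗ[k] E}
    (hι : IsInjectiveEnvelope k C ι) (Q : Submodule k E)
    (hQ : ∀ (f : DualAlg k C), ∀ m ∈ Q, act f m ∈ Q) (h : ∀ s, ι s ∈ Q → s = 0) : Q = ⊥ := by
  apply hι.essential (subcomoduleOfStable (C := C) Q hQ)
  rw [eq_bot_iff]
  rintro _ ⟨hx, s, rfl⟩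
  rw [h s hx, map_zero]
  exact zero_mem _

/-- The preimage of `Q` in the simple comodule `S` is zero or everything; if it is zero,
essentiality kills `Q`. So the image of `S` is the least nonzero subcomodule of its envelope. -/
lemma stable_eq_bot_or {S E : Type v} [AddCommGroup S] [Module k S] [LeftComodule k C S]
    [AddCommGroup E] [Module k E] [LeftComodule k C E] {ι : S →ₗ[k] E} (hS : IsSimple k C S)
    (hι : IsInjectiveEnvelope k C ι) (Q : Submodule k E)
    (hQ : ∀ (f : DualAlg k C), ∀ m ∈ Q, act f m ∈ Q) : Q = ⊥ ∨ LinearMap.range ι ≤ Q := by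
  rcases hS.2 (subcomoduleOfStable (C := C) (Q.comap ι) fun f s hs => by
    rw [Submodule.mem_comap, (isHom_iff ι).1 hι.isHom]; exact hQ f _ hs) with h | h
  · left
    refine hι.eq_bot_of_stable Q hQ fun s hs => ?_
    have : s ∈ (⊥ : Submodule k S) := h ▸ hs
    exact (Submodule.mem_bot k).1 this
  · right
    rintro _ ⟨s, rfl⟩
    have h' : Q.comap ι = ⊤ := h
    have : s ∈ Q.comap ι := h' ▸ Submodule.mem_top
    exact this

variable (C) in
/-- The comodule map `M → C`, `m ↦ ∑ m₋₁ γ(m₀)`, attached to a functional `γ` on `M`. -/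
def homOfFunctional (γ : M →ₗ[k] k) : M →ₗ[k] C :=
  (TensorProduct.rid k C).toLinearMap ∘ₗ LinearMap.lTensor C γ ∘ₗ coact (k := k) (C := C)

/-- This identity determines the map completely, because functionals separate points of `C`; later
arguments use it in place of the tensor formula. -/
lemma apply_homOfFunctional (γ : M →ₗ[k] k) (f : DualAlg k C) (m : M) :
    f.ofConv (homOfFunctional C γ m) = γ (act f m) := by
  rw [act_apply]
  change f.ofConv (TensorProduct.rid k C (LinearMap.lTensor C γ (coact m))) = _
  induction coact (k := k) (C := C) m with
  | zero => simp
  | add y z hy hz => simp only [map_add, hy, hz]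
  | tmul c m => simp [mul_comm]

end LeftComodule

/-! ### Right comodules as left C*-modules -/

namespace RightComodule

variable {k : Type u} {C : Type v} [Field k] [AddCommGroup C] [Module k C] [Coalgebra k C]
variable {M : Type*} [AddCommGroup M] [Module k M] [RightComodule k C M]
variable {N : Type*} [AddCommGroup N] [Module k N] [RightComodule k C N]

lemma act_apply (f : DualAlg k C) (m : M) : act f m =
    TensorProduct.rid k M (LinearMap.lTensor M f.ofConv (coact (k := k) (C := C) m)) := rfl

lemma isHom_iff (g : M →ₗ[k] N) :
    IsHom k C g ↔ ∀ (f : DualAlg k C) (m : M), g (act f m) = act f (g m) := by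
  have nat : ∀ (f : C →ₗ[k] k) (x : M ⊗[k] C),
      g (TensorProduct.rid k M (LinearMap.lTensor M f x)) =
        TensorProduct.rid k N (LinearMap.lTensor N f (LinearMap.rTensor C g x)) := by
    intro f x
    induction x with
    | zero => simp
    | add y z hy hz => simp [hy, hz]
    | tmul c m => simp
  constructor
  · intro h f m
    have := LinearMap.congr_fun h m
    simp only [LinearMap.comp_apply] at this
    rw [act_apply, act_apply, nat, this]
  · intro h
    ext m
    rw [← sub_eq_zero]
    apply eq_zero_of_forall_rid_lTensor
    intro f
    have := h (WithConv.toConv f) m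
    rw [act_apply, act_apply, nat] at this
    simpa [sub_eq_zero] using this

/-- A subspace stable under the operators of `C*` is a subcomodule. -/
def subcomoduleOfStable (Q : Submodule k M) (h : ∀ (f : DualAlg k C), ∀ m ∈ Q, act f m ∈ Q) :
    RightSubcomodule k C M where
  toSubmodule := Q
  coact_mem m hm := by
    obtain ⟨P, hP, hPQ⟩ := exists_idempotent_of_submodule Q
    have key : LinearMap.rTensor C P (coact (k := k) (C := C) m) = coact (k := k) (C := C) m := by
      rw [← sub_eq_zero]
      apply eq_zero_of_forall_rid_lTensor
      intro f
      have nat : ∀ x : M ⊗[k] C,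
          TensorProduct.rid k M (LinearMap.lTensor M f (LinearMap.rTensor C P x)) =
          P (TensorProduct.rid k M (LinearMap.lTensor M f x)) := by
        intro x
        induction x with
        | zero => simp
        | add y z hy hz => simp [hy, hz]
        | tmul c m => simp
      rw [map_sub, map_sub, nat]
      have := hPQ _ (h (WithConv.toConv f) m hm)
      rw [act_apply] at this
      exact sub_eq_zero.2 this
    rw [← key]
    have e : P = Q.subtype ∘ₗ P.codRestrict Q hP := rfl
    rw [e, LinearMap.rTensor_comp]
    exact ⟨_, rfl⟩

lemma coe_act (f : DualAlg k C) (Q : RightSubcomodule k C M) (m : Q.toSubmodule) :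
    ((act f m : Q.toSubmodule) : M) = act f (m : M) :=
  (isHom_iff (C := C) Q.toSubmodule.subtype).1 (RightSubcomodule.rTensor_coact Q) f m

/-- A right `C`-comodule is a left `C*`-module via `f · m = ∑ f(m₁) m₀`. -/
instance module : Module (DualAlg k C) M where
  smul f m := act f m
  one_smul m := LinearMap.congr_fun (act_one k C) m
  mul_smul f g m := LinearMap.congr_fun (act_mul k C f g) m
  smul_zero f := map_zero _
  smul_add f := map_add _
  add_smul f g m := by
    change act (f + g) m = act f m + act g m
    simp [act, LinearMap.lTensor_add]
  zero_smul m := by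
    change act (0 : DualAlg k C) m = 0
    simp [act]

instance : IsScalarTower k (DualAlg k C) M where
  smul_assoc a f m := by
    change act (a • f) m = a • act f m
    simp [act, LinearMap.lTensor_smul]

lemma act_add (f g : DualAlg k C) (m : M) : act (f + g) m = act f m + act g m :=
  add_smul f g m

lemma act_smul (a : k) (f : DualAlg k C) (m : M) : act (a • f) m = a • act f m :=
  smul_assoc a f m

lemma act_mul_apply (f g : DualAlg k C) (m : M) : act (f * g) m = act f (act g m) :=
  LinearMap.congr_fun (act_mul k C f g) m

lemma act_one_apply (m : M) : act (1 : DualAlg k C) m = m :=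
  LinearMap.congr_fun (act_one k C) m

lemma IsInjectiveEnvelope.eq_bot_of_stable {T E : Type v} [AddCommGroup T] [Module k T]
    [RightComodule k C T] [AddCommGroup E] [Module k E] [RightComodule k C E] {ι : T →ₗ[k] E}
    (hι : IsInjectiveEnvelope k C ι) (Q : Submodule k E)
    (hQ : ∀ (f : DualAlg k C), ∀ m ∈ Q, act f m ∈ Q) (h : ∀ s, ι s ∈ Q → s = 0) : Q = ⊥ := by
  apply hι.essential (subcomoduleOfStable (C := C) Q hQ)
  rw [eq_bot_iff]
  rintro _ ⟨hx, s, rfl⟩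
  rw [h s hx, map_zero]
  exact zero_mem _

lemma stable_eq_bot_or {T E : Type v} [AddCommGroup T] [Module k T] [RightComodule k C T]
    [AddCommGroup E] [Module k E] [RightComodule k C E] {ι : T →ₗ[k] E} (hT : IsSimple k C T)
    (hι : IsInjectiveEnvelope k C ι) (Q : Submodule k E)
    (hQ : ∀ (f : DualAlg k C), ∀ m ∈ Q, act f m ∈ Q) : Q = ⊥ ∨ LinearMap.range ι ≤ Q := by
  rcases hT.2 (subcomoduleOfStable (C := C) (Q.comap ι) fun f s hs => by
    rw [Submodule.mem_comap, (isHom_iff ι).1 hι.isHom]; exact hQ f _ hs) with h | h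
  · left
    refine hι.eq_bot_of_stable Q hQ fun s hs => ?_
    have : s ∈ (⊥ : Submodule k T) := h ▸ hs
    exact (Submodule.mem_bot k).1 this
  · right
    rintro _ ⟨s, rfl⟩
    have h' : Q.comap ι = ⊤ := h
    have : s ∈ Q.comap ι := h' ▸ Submodule.mem_top
    exact this

/-- The map `f ↦ f · m` from `C*` to a right comodule. -/
def orbitMap (m : M) : DualAlg k C →ₗ[k] M where
  toFun f := act f m
  map_add' f g := act_add f g m
  map_smul' a f := act_smul a f m

-- Only finitely many first legs occur in an expression of the coaction of `m`, and they span a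
-- space containing the whole orbit.
variable (k C) in
lemma finiteDimensional_range_orbitMap (m : M) :
    FiniteDimensional k (LinearMap.range (orbitMap (k := k) (C := C) m)) := by
  obtain ⟨s, hs⟩ := TensorProduct.exists_finset (coact (k := k) (C := C) m)
  classical
  have : LinearMap.range (orbitMap (k := k) (C := C) m) ≤
      Submodule.span k (s.image Prod.fst : Finset M) := by
    rintro _ ⟨f, rfl⟩
    change act f m ∈ _
    rw [act_apply, hs, map_sum, map_sum]
    refine Submodule.sum_mem _ fun i hi => ?_
    simp only [LinearMap.lTensor_tmul, TensorProduct.rid_tmul]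
    exact Submodule.smul_mem _ _
      (Submodule.subset_span (Finset.mem_coe.2 (Finset.mem_image_of_mem _ hi)))
  exact Submodule.finiteDimensional_of_le this

variable (C) in
/-- The comodule map `M → C`, `m ↦ ∑ γ(m₀) m₁`, attached to a functional `γ` on `M`. -/
def homOfFunctional (γ : M →ₗ[k] k) : M →ₗ[k] C :=
  (TensorProduct.lid k C).toLinearMap ∘ₗ LinearMap.rTensor C γ ∘ₗ coact (k := k) (C := C)

lemma apply_homOfFunctional (γ : M →ₗ[k] k) (f : DualAlg k C) (m : M) :
    f.ofConv (homOfFunctional C γ m) = γ (act f m) := by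
  rw [act_apply]
  change f.ofConv (TensorProduct.lid k C (LinearMap.rTensor C γ (coact m))) = _
  induction coact (k := k) (C := C) m with
  | zero => simp
  | add y z hy hz => simp only [map_add, hy, hz]
  | tmul c m => simp [mul_comm]

end RightComodule

/-! ### The two actions of C* on C as transposes of convolution -/

section Regular

variable {k : Type u} {C : Type v} [Field k] [AddCommGroup C] [Module k C] [Coalgebra k C]

omit [Coalgebra k C] in
lemma eq_of_forall_dual_apply {c d : C} (h : ∀ f : DualAlg k C, f.ofConv c = f.ofConv d) :
    c = d := by
  rw [← sub_eq_zero, ← Module.forall_dual_apply_eq_zero_iff k]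
  intro f
  rw [map_sub, sub_eq_zero]
  exact h (WithConv.toConv f)

/-- Together with its left counterpart and separation by functionals, this turns identities between
actions on `C` into associativity and unit laws of C*. -/
lemma convMul_apply_right (f g : DualAlg k C) (c : C) :
    (f * g).ofConv c = f.ofConv (RightComodule.act g c) := by
  change LinearMap.mul' k k (TensorProduct.map f.ofConv g.ofConv (Coalgebra.comul c)) =
    f.ofConv (TensorProduct.rid k C (LinearMap.lTensor C g.ofConv (Coalgebra.comul c)))
  induction Coalgebra.comul (R := k) c with
  | zero => simp
  | add y z hy hz => simp only [map_add, hy, hz]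
  | tmul c m => simp [mul_comm]

lemma convMul_apply_left (f g : DualAlg k C) (c : C) :
    (f * g).ofConv c = g.ofConv (LeftComodule.act f c) := by
  change LinearMap.mul' k k (TensorProduct.map f.ofConv g.ofConv (Coalgebra.comul c)) =
    g.ofConv (TensorProduct.lid k C (LinearMap.rTensor C f.ofConv (Coalgebra.comul c)))
  induction Coalgebra.comul (R := k) c with
  | zero => simp
  | add y z hy hz => simp only [map_add, hy, hz]
  | tmul c m => simp

lemma counit_act_right (f : DualAlg k C) (c : C) :
    Coalgebra.counit (R := k) (RightComodule.act f c) = f.ofConv c := by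
  have := convMul_apply_right 1 f c
  rw [one_mul] at this
  exact this.symm

lemma counit_act_left (f : DualAlg k C) (c : C) :
    Coalgebra.counit (R := k) (LeftComodule.act f c) = f.ofConv c := by
  have := convMul_apply_left f 1 c
  rw [mul_one] at this
  exact this.symm

end Regular

/-! ### Mapping injective envelopes into C -/

namespace LeftComodule

variable {k : Type u} {C : Type v} [Field k] [AddCommGroup C] [Module k C] [Coalgebra k C]
variable {M : Type*} [AddCommGroup M] [Module k M] [LeftComodule k C M]

lemma homOfFunctional_act (γ : M →ₗ[k] k) (f : DualAlg k C) (m : M) :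
    homOfFunctional C γ (act f m) = act f (homOfFunctional C γ m) := by
  apply eq_of_forall_dual_apply (k := k)
  intro g
  rw [apply_homOfFunctional, ← convMul_apply_left, apply_homOfFunctional, act_mul_apply]

/-- An injective envelope of a subcomodule `S` of `C` embeds in `C` as a direct summand,
compatibly with the inclusion of `S`. -/
lemma exists_hom_retraction {S : LeftSubcomodule k C C} {E : Type v} [AddCommGroup E] [Module k E]
    [LeftComodule k C E] {ι : S.toSubmodule →ₗ[k] E} (hι : IsInjectiveEnvelope k C ι) :
    ∃ (u : E →ₗ[k] C) (p : C →ₗ[k] E), IsHom k C u ∧ IsHom k C p ∧ (∀ s, u (ι s) = s) ∧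
      ∀ m, p (u m) = m := by
  obtain ⟨r, hr⟩ := ι.exists_leftInverse_of_injective (LinearMap.ker_eq_bot.2 hι.injective)
  -- Comodule maps into `C` correspond to functionals. The inclusion of `S` corresponds to the
  -- counit on `S`, so any linear extension of that functional to `E` gives a map extending the
  -- inclusion.
  let γ : E →ₗ[k] k := Coalgebra.counit ∘ₗ S.toSubmodule.subtype ∘ₗ r
  have hom : IsHom k C (homOfFunctional C γ) := (isHom_iff _).2 (homOfFunctional_act γ)
  have hu : ∀ s, homOfFunctional C γ (ι s) = (s : C) := by
    intro s
    apply eq_of_forall_dual_apply (k := k)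
    intro f
    rw [apply_homOfFunctional, ← (isHom_iff ι).1 hι.isHom]
    change Coalgebra.counit ((r (ι (act f s)) : S.toSubmodule) : C) = _
    rw [← LinearMap.comp_apply, hr, LinearMap.id_apply, coe_act, counit_act_left]
  have inj : Function.Injective (homOfFunctional C γ) := by
    rw [← LinearMap.ker_eq_bot]
    refine hι.eq_bot_of_stable _ (fun f m hm => ?_) fun s hs => ?_
    · rw [LinearMap.mem_ker] at hm ⊢
      rw [homOfFunctional_act, hm, map_zero]
    · rw [LinearMap.mem_ker, hu] at hs
      exact Subtype.ext hs
  -- Injectivity of `E` extends its identity along the embedding, and so splits it.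
  obtain ⟨p, hp, hpu⟩ := hι.isInjective E C _ LinearMap.id hom inj
    ((isHom_iff _).2 fun _ _ => rfl)
  exact ⟨_, p, hom, hp, hu, LinearMap.congr_fun hpu⟩

end LeftComodule

namespace RightComodule

variable {k : Type u} {C : Type v} [Field k] [AddCommGroup C] [Module k C] [Coalgebra k C]
variable {M : Type*} [AddCommGroup M] [Module k M] [RightComodule k C M]

lemma homOfFunctional_act (γ : M →ₗ[k] k) (f : DualAlg k C) (m : M) :
    homOfFunctional C γ (act f m) = act f (homOfFunctional C γ m) := by
  apply eq_of_forall_dual_apply (k := k)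
  intro g
  rw [apply_homOfFunctional, ← convMul_apply_right, apply_homOfFunctional, act_mul_apply]

/-- A comodule containing a subcomodule `T` of `C` maps to `C` compatibly with the
inclusion of `T`. -/
lemma exists_hom {T : RightSubcomodule k C C} {E : Type v} [AddCommGroup E] [Module k E]
    [RightComodule k C E] {ι : T.toSubmodule →ₗ[k] E} (hom : IsHom k C ι)
    (inj : Function.Injective ι) :
    ∃ v : E →ₗ[k] C, IsHom k C v ∧ ∀ t, v (ι t) = t := by
  obtain ⟨r, hr⟩ := ι.exists_leftInverse_of_injective (LinearMap.ker_eq_bot.2 inj)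
  let γ : E →ₗ[k] k := Coalgebra.counit ∘ₗ T.toSubmodule.subtype ∘ₗ r
  refine ⟨homOfFunctional C γ, (isHom_iff _).2 (homOfFunctional_act γ), fun t => ?_⟩
  apply eq_of_forall_dual_apply (k := k)
  intro f
  rw [apply_homOfFunctional, ← (isHom_iff ι).1 hom]
  change Coalgebra.counit ((r (ι (act f t)) : T.toSubmodule) : C) = _
  rw [← LinearMap.comp_apply, hr, LinearMap.id_apply, coe_act, counit_act_right]

end RightComodule

/-! ### Perfect balanced pairings -/

section Pairing

variable {k : Type u} {C : Type v} [Field k] [AddCommGroup C] [Module k C] [Coalgebra k C]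

/-- A balanced pairing `β` between an injective envelope `E` of a simple left comodule `S` and an
essential extension `Y` of a simple right comodule is perfect as soon as it is nonzero on `S`. -/
lemma bijective_of_balanced {S E : Type v} [AddCommGroup S] [Module k S] [LeftComodule k C S]
    [AddCommGroup E] [Module k E] [LeftComodule k C E] {ι : S →ₗ[k] E}
    (hS : LeftComodule.IsSimple k C S) (hι : LeftComodule.IsInjectiveEnvelope k C ι)
    {T Y : Type v} [AddCommGroup T] [Module k T] [RightComodule k C T]
    [AddCommGroup Y] [Module k Y] [RightComodule k C Y] {κ : T →ₗ[k] Y}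
    (hT : RightComodule.IsSimple k C T) (hκ : RightComodule.IsInjectiveEnvelope k C κ)
    (β : E →ₗ[k] Y →ₗ[k] k)
    (hβ : ∀ (f : DualAlg k C) m y, β (LeftComodule.act f m) y = β m (RightComodule.act f y))
    {u : E →ₗ[k] C} {p : C →ₗ[k] E} (hu : LeftComodule.IsHom k C u)
    (hp : LeftComodule.IsHom k C p) (hpu : ∀ m, p (u m) = m) {s : S} {y : Y}
    (h : β (ι s) y ≠ 0) :
    FiniteDimensional k E ∧ Function.Bijective β ∧
      ∃ y₀, ∀ m, β m y₀ = Coalgebra.counit (R := k) (u m) := by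
  rw [LeftComodule.isHom_iff] at hu hp
  -- Pairing `E` against the finite-dimensional orbit of `y` alone already has zero kernel: the
  -- kernel is a subcomodule that does not contain `ι s`. This bounds the dimension of `E`.
  let o := RightComodule.orbitMap (k := k) (C := C) y
  have : FiniteDimensional k (LinearMap.range o) :=
    RightComodule.finiteDimensional_range_orbitMap k C y
  have ho : ∀ f, o f = RightComodule.act f y := fun _ => rfl
  let β' : E →ₗ[k] LinearMap.range o →ₗ[k] k :=
    (LinearMap.lcomp k k (LinearMap.range o).subtype) ∘ₗ β
  have hβ' : ∀ m, m ∈ LinearMap.ker β' ↔ ∀ f : DualAlg k C, β m (RightComodule.act f y) = 0 := by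
    intro m
    rw [LinearMap.mem_ker]
    constructor
    · intro hm f
      exact LinearMap.congr_fun hm ⟨o f, f, rfl⟩
    · intro hm
      ext ⟨_, f, rfl⟩
      exact hm f
  have ker' : LinearMap.ker β' = ⊥ := by
    rcases LeftComodule.stable_eq_bot_or hS hι (LinearMap.ker β') (fun f m hm => by
      rw [hβ'] at hm ⊢
      intro g
      rw [hβ, ← RightComodule.act_mul_apply]
      exact hm _) with hk | hk
    · exact hk
    · have := (hβ' _).1 (hk ⟨s, rfl⟩) 1
      rw [RightComodule.act_one_apply] at this
      exact absurd this h
  have fin : FiniteDimensional k E :=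
    FiniteDimensional.of_injective β' (LinearMap.ker_eq_bot.1 ker')
  have inj : Function.Injective β :=
    Function.Injective.of_comp (f := LinearMap.lcomp k k (LinearMap.range o).subtype)
      (LinearMap.ker_eq_bot.1 ker')
  -- Since `E` is finite-dimensional, injectivity of E → Y* dualizes to surjectivity of Y → E*. A
  -- preimage `y₀` of the functional ε ∘ u will generate a copy of E* inside `Y`.
  have surj : Function.Surjective β.flip := LinearMap.flip_surjective_iff₁.2 inj
  obtain ⟨y₀, hy₀⟩ := surj (Coalgebra.counit ∘ₗ u)
  have hy₀ : ∀ m, β m y₀ = Coalgebra.counit (R := k) (u m) := LinearMap.congr_fun hy₀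
  refine ⟨fin, ⟨inj, LinearMap.flip_injective_iff₁.1 ?_⟩, y₀, hy₀⟩
  -- This is a `C*`-linear section of Y → E*: by balance, σ(α) pairs with m to ε(u(m) · (α ∘ p)) =
  -- α(p(u(m))) = α(m).
  let σ : (E →ₗ[k] k) → Y := fun α => RightComodule.act (WithConv.toConv (α ∘ₗ p)) y₀
  have hσ : ∀ α m, β m (σ α) = α m := by
    intro α m
    rw [← hβ, hy₀, hu, counit_act_left]
    change α (p (u m)) = _
    rw [hpu]
  have hσact : ∀ (f : DualAlg k C) α, RightComodule.act f (σ α) = σ (α ∘ₗ LeftComodule.act f) := by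
    intro f α
    change RightComodule.act f (RightComodule.act _ y₀) = RightComodule.act _ y₀
    rw [← RightComodule.act_mul_apply]
    congr 1
    congr 1
    ext c
    rw [convMul_apply_left]
    change α (p _) = α (LeftComodule.act f (p c))
    rw [hp]
  rw [← LinearMap.ker_eq_bot]
  rcases RightComodule.stable_eq_bot_or hT hκ (LinearMap.ker β.flip) (fun f x hx => by
    rw [LinearMap.mem_ker] at hx ⊢
    ext m
    rw [LinearMap.flip_apply, ← hβ]
    exact LinearMap.congr_fun hx _) with hk | hk
  · exact hk
  · exfalso
    -- If the kernel of Y → E* contained the image of `T`, the image of the section would meet that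
    -- of `T` only in zero. Essentiality would make the section zero, so that E* = 0, against `h`.
    let Q : Submodule k Y :=
      { carrier := Set.range σ
        add_mem' := by
          rintro _ _ ⟨α, rfl⟩ ⟨α', rfl⟩
          exact ⟨α + α', RightComodule.act_add (WithConv.toConv (α ∘ₗ p))
            (WithConv.toConv (α' ∘ₗ p)) y₀⟩
        zero_mem' := ⟨0, by simp [σ, RightComodule.act]⟩
        smul_mem' := by
          rintro a _ ⟨α, rfl⟩
          exact ⟨a • α, RightComodule.act_smul a (WithConv.toConv (α ∘ₗ p)) y₀⟩ }
    have hQ : Q = ⊥ := by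
      refine hκ.eq_bot_of_stable Q ?_ ?_
      · rintro f _ ⟨α, rfl⟩
        exact ⟨_, (hσact f α).symm⟩
      · rintro t ⟨α, hα⟩
        have hz : α = 0 := by
          ext m
          rw [← hσ, hα]
          exact LinearMap.congr_fun (hk ⟨t, rfl⟩ : β.flip (κ t) = 0) m
        apply hκ.injective
        rw [← hα, hz, map_zero]
        simp [σ, RightComodule.act]
    have hz : ∀ α, σ α = 0 := fun α => (Submodule.mem_bot k).1 (hQ ▸ (⟨α, rfl⟩ : σ α ∈ Q))
    apply h
    rw [show β (ι s) y = (β.flip y) (ι s) from rfl, ← hσ (β.flip y), hz, map_zero]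

end Pairing

/-! ### Simple right subcomodules and the coradical -/

lemma Submodule.exists_isSimpleModule_le_of_isArtinian {R M : Type*} [Ring R] [AddCommGroup M]
    [Module R M] {Q : Submodule R M} [IsArtinian R Q] (hQ : Q ≠ ⊥) :
    ∃ T ≤ Q, IsSimpleModule R T := by
  have : Nontrivial Q := Submodule.nontrivial_iff_ne_bot.2 hQ
  obtain ⟨A, hA⟩ := IsAtomic.exists_atom (Submodule R Q)
  have : IsSimpleModule R A := isSimpleModule_iff_isAtom.2 hA
  exact ⟨A.map Q.subtype, Submodule.map_subtype_le _ _,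
    IsSimpleModule.congr (A.equivMapOfInjective _ Q.subtype_injective).symm⟩

section Coradical

variable {k : Type u} {C : Type v} [Field k] [AddCommGroup C] [Module k C] [Coalgebra k C]

/-- Stability on both sides puts Δ(K) in the intersection of C ⊗ K and K ⊗ C; a projection P onto
`K` then gives (P ⊗ P)Δ = Δ on `K`, which places Δ(K) in K ⊗ K. -/
lemma isSubcoalgebra_of_stable (K : Submodule k C)
    (hl : ∀ (f : DualAlg k C), ∀ c ∈ K, LeftComodule.act f c ∈ K)
    (hr : ∀ (f : DualAlg k C), ∀ c ∈ K, RightComodule.act f c ∈ K) : IsSubcoalgebra k K := by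
  intro d hd
  obtain ⟨P, hP, hPK⟩ := exists_idempotent_of_submodule K
  have e : P ∘ₗ K.subtype = K.subtype := by ext x; exact hPK _ x.2
  have h1 : LinearMap.lTensor C P (Coalgebra.comul (R := k) d) = Coalgebra.comul (R := k) d := by
    obtain ⟨x, hx⟩ : ∃ x : C ⊗[k] K, LinearMap.lTensor C K.subtype x = Coalgebra.comul (R := k) d :=
      (LeftComodule.subcomoduleOfStable K hl).coact_mem d hd
    rw [← hx, ← LinearMap.comp_apply, ← LinearMap.lTensor_comp, e]
  have h2 : LinearMap.rTensor C P (Coalgebra.comul (R := k) d) = Coalgebra.comul (R := k) d := by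
    obtain ⟨x, hx⟩ : ∃ x : K ⊗[k] C, LinearMap.rTensor C K.subtype x = Coalgebra.comul (R := k) d :=
      (RightComodule.subcomoduleOfStable K hr).coact_mem d hd
    rw [← hx, ← LinearMap.comp_apply, ← LinearMap.rTensor_comp, e]
  refine ⟨TensorProduct.map (P.codRestrict K hP) (P.codRestrict K hP)
    (Coalgebra.comul (R := k) d), ?_⟩
  rw [TensorProduct.mapIncl, ← LinearMap.comp_apply, ← TensorProduct.map_comp]
  change TensorProduct.map P P _ = _
  rw [← LinearMap.rTensor_comp_lTensor, LinearMap.comp_apply, h1, h2]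

lemma IsSubcoalgebra.act_left_mem {D : Submodule k C} (hD : IsSubcoalgebra k D)
    (f : DualAlg k C) {d : C} (hd : d ∈ D) : LeftComodule.act f d ∈ D := by
  obtain ⟨x, hx⟩ := hD d hd
  change TensorProduct.lid k C (LinearMap.rTensor C f.ofConv (Coalgebra.comul (R := k) d)) ∈ D
  rw [← hx]
  clear hx
  induction x with
  | zero => simp
  | add y z hy hz => simpa using add_mem hy hz
  | tmul a b => simpa [TensorProduct.mapIncl] using D.smul_mem _ b.2

lemma IsSubcoalgebra.act_right_mem {D : Submodule k C} (hD : IsSubcoalgebra k D)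
    (f : DualAlg k C) {d : C} (hd : d ∈ D) : RightComodule.act f d ∈ D := by
  obtain ⟨x, hx⟩ := hD d hd
  change TensorProduct.rid k C (LinearMap.lTensor C f.ofConv (Coalgebra.comul (R := k) d)) ∈ D
  rw [← hx]
  clear hx
  induction x with
  | zero => simp
  | add y z hy hz => simpa using add_mem hy hz
  | tmul a b => simpa [TensorProduct.mapIncl] using D.smul_mem _ a.2

lemma RightComodule.finiteDimensional_span_singleton {M : Type*} [AddCommGroup M] [Module k M]
    [RightComodule k C M] (x : M) :
    FiniteDimensional k ((Submodule.span (DualAlg k C) {x}).restrictScalars k) := by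
  have := RightComodule.finiteDimensional_range_orbitMap k C x
  refine Submodule.finiteDimensional_of_le
    (S₂ := LinearMap.range (RightComodule.orbitMap (k := k) (C := C) x)) ?_
  intro z hz
  obtain ⟨f, rfl⟩ := Submodule.mem_span_singleton.1 ((Submodule.restrictScalars_mem k _ z).1 hz)
  exact ⟨f, rfl⟩

/-- A nonzero cyclic submodule is finite-dimensional over `k`, hence Artinian over C*. -/
lemma RightComodule.exists_isSimpleModule_le {M : Type*} [AddCommGroup M] [Module k M]
    [RightComodule k C M] {N : Submodule (DualAlg k C) M} (hN : N ≠ ⊥) :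
    ∃ T ≤ N, IsSimpleModule (DualAlg k C) T := by
  obtain ⟨x, hx, hx0⟩ := (Submodule.ne_bot_iff N).1 hN
  let Q := Submodule.span (DualAlg k C) {x}
  have : FiniteDimensional k (Q.restrictScalars k) :=
    RightComodule.finiteDimensional_span_singleton x
  have : IsArtinian k Q := inferInstanceAs (IsArtinian k (Q.restrictScalars k))
  have : IsArtinian (DualAlg k C) Q := isArtinian_of_tower k this
  have hQ : Q ≠ ⊥ := fun h => hx0 (Submodule.span_singleton_eq_bot.1 h)
  obtain ⟨T, hT, hT'⟩ := Submodule.exists_isSimpleModule_le_of_isArtinian hQ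
  exact ⟨T, hT.trans ((Submodule.span_singleton_le_iff_mem _ _).2 hx), hT'⟩

/-- `LeftComodule.act f` as a `C*`-linear endomorphism of the right comodule `C`. -/
def LeftComodule.actEnd (f : DualAlg k C) : C →ₗ[DualAlg k C] C where
  toFun := LeftComodule.act f
  map_add' := map_add _
  map_smul' g c := by
    apply eq_of_forall_dual_apply (k := k)
    intro h
    change h.ofConv (LeftComodule.act f (RightComodule.act g c)) =
      h.ofConv (RightComodule.act g (LeftComodule.act f c))
    rw [← convMul_apply_left, ← convMul_apply_right, ← convMul_apply_right,
      ← convMul_apply_left, mul_assoc]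

/-- Every `C*`-linear map from a right subcomodule of `C` to `C` is given by the left comodule
action of some functional. -/
lemma RightComodule.exists_eq_act_left (T : Submodule (DualAlg k C) C)
    (g : T →ₗ[DualAlg k C] C) : ∃ f : DualAlg k C, ∀ t : T, g t = LeftComodule.act f (t : C) := by
  obtain ⟨P, hP, hPT⟩ := exists_idempotent_of_submodule (T.restrictScalars k)
  let P' : C →ₗ[k] T.restrictScalars k := P.codRestrict _ hP
  have hP' : ∀ t : T, P' t = t := fun t => Subtype.ext (hPT _ t.2)
  let g' : T.restrictScalars k →ₗ[k] C := g.restrictScalars k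
  -- A map into `C` is determined by its composite with the counit, so extending that functional
  -- from `T` to `C` by the projection gives the required element of C*.
  refine ⟨WithConv.toConv (Coalgebra.counit ∘ₗ g' ∘ₗ P'), fun t => ?_⟩
  apply eq_of_forall_dual_apply (k := k)
  intro φ
  rw [← convMul_apply_left, convMul_apply_right, ← counit_act_right φ (g t)]
  change _ = Coalgebra.counit (R := k) (g (P' ((φ • t : T) : C)))
  rw [hP', map_smul]
  rfl

/-- The isotypic component of `T` in the right comodule `C` is a simple subcoalgebra. It is
invariant under the left comodule action, which is by endomorphisms, and that action carries any
simple submodule of type `T` onto any other. -/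
lemma RightComodule.simple_le_coradical (T : Submodule (DualAlg k C) C)
    [hT : IsSimpleModule (DualAlg k C) T] : T.restrictScalars k ≤ coradical k C := by
  let K := isotypicComponent (DualAlg k C) C T
  have hTK : T ≤ K := T.le_isotypicComponent
  refine le_trans (b := K.restrictScalars k) hTK (le_sSup ⟨?_, ?_, ?_⟩)
  · refine isSubcoalgebra_of_stable _ (fun f c hc => ?_) fun f c hc => K.smul_mem f hc
    exact Submodule.IsFullyInvariant.isotypicComponent (DualAlg k C) C T (LeftComodule.actEnd f) hc
  · intro h
    have h' : K = ⊥ := (Submodule.restrictScalars_eq_bot_iff k (DualAlg k C) C).1 h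
    exact (bot_lt_isotypicComponent T).ne' h'
  · intro A hAK hA
    rw [or_iff_not_imp_left]
    intro hA0
    let A' : Submodule (DualAlg k C) C :=
      { A with smul_mem' := fun f c hc => hA.act_right_mem f hc }
    have hA'0 : A' ≠ ⊥ := by
      obtain ⟨x, hx, hx0⟩ := (Submodule.ne_bot_iff A).1 hA0
      exact (Submodule.ne_bot_iff A').2 ⟨x, hx, hx0⟩
    obtain ⟨T', hT'A, hT'⟩ := RightComodule.exists_isSimpleModule_le hA'0
    have iso : IsIsotypicOfType (DualAlg k C) K T :=
      IsIsotypicOfType.isotypicComponent (DualAlg k C) C T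
    obtain ⟨e⟩ := isIsotypicOfType_submodule_iff.1 iso T' (hT'A.trans hAK)
    refine le_antisymm hAK ?_
    change K ≤ A'
    refine sSup_le ?_
    rintro m ⟨e'⟩ x hx
    -- The isomorphism from `T'` to the arbitrary copy `m` of `T` is the action of some functional,
    -- which preserves the subcoalgebra `A`; hence `m` lies in `A`.
    obtain ⟨f, hf⟩ := RightComodule.exists_eq_act_left T'
      (m.subtype ∘ₗ (e.trans e'.symm).toLinearMap)
    have := hf ((e.trans e'.symm).symm ⟨x, hx⟩)
    simp only [LinearMap.comp_apply, LinearEquiv.coe_coe, LinearEquiv.apply_symm_apply] at this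
    change x = _ at this
    rw [this]
    exact hA.act_left_mem f (hT'A (Subtype.mem _))

/-- This is essentiality of the coradical in `C` as a right comodule. -/
lemma RightComodule.exists_mem_coradical {N : Submodule (DualAlg k C) C} (hN : N ≠ ⊥) :
    ∃ x ∈ N, x ∈ coradical k C ∧ x ≠ 0 := by
  obtain ⟨T, hTN, hT⟩ := RightComodule.exists_isSimpleModule_le hN
  have := IsSimpleModule.nontrivial (DualAlg k C) T
  obtain ⟨x, hx⟩ := exists_ne (0 : T)
  exact ⟨x, hTN x.2, RightComodule.simple_le_coradical T x.2, fun h => hx (Subtype.ext h)⟩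

end Coradical

/-! ### Direct sums and essential submodules over a ring -/

section ModuleSums

variable {R : Type*} [Ring R] {J : Type*} [DecidableEq J] {E : J → Type*}
  [∀ j, AddCommGroup (E j)] [∀ j, Module R (E j)] {M : Type*} [AddCommGroup M] [Module R M]

/-- A map out of a direct sum is injective if it is injective on a sum of essential submodules. -/
lemma DFinsupp.injective_lsum_of_essential (V : ∀ j, E j →ₗ[R] M) (Q : ∀ j, Submodule R (E j))
    (hQ : ∀ j (x : E j), x ≠ 0 → ∃ r : R, r • x ∈ Q j ∧ r • x ≠ 0)
    (hV : ∀ z : Π₀ j, E j, (∀ j, z j ∈ Q j) → DFinsupp.lsum ℕ V z = 0 → z = 0) :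
    Function.Injective (DFinsupp.lsum ℕ V) := by
  rw [injective_iff_map_eq_zero]
  intro z hz
  by_contra hz0
  -- One scalar at a time pushes a coordinate into its `Q j` while keeping it nonzero; coordinates
  -- already treated stay inside, the `Q j` being submodules.
  have claim : ∀ A : Finset J, ∃ r : R, r • z ≠ 0 ∧ ∀ j ∈ A, (r • z) j ∈ Q j := by
    intro A
    induction A using Finset.induction_on with
    | empty => exact ⟨1, by simpa using hz0, by simp⟩
    | insert a A _ ih =>
      obtain ⟨r, hr, hrA⟩ := ih
      by_cases h : (r • z) a = 0
      · refine ⟨r, hr, fun j hj => ?_⟩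
        rcases Finset.mem_insert.1 hj with rfl | hj
        · rw [h]; exact zero_mem _
        · exact hrA j hj
      · obtain ⟨q, hq, hq0⟩ := hQ a _ h
        refine ⟨q * r, fun h0 => hq0 ?_, fun j hj => ?_⟩
        · rw [← DFinsupp.smul_apply, smul_smul, h0, DFinsupp.zero_apply]
        · rw [mul_smul, DFinsupp.smul_apply]
          rcases Finset.mem_insert.1 hj with rfl | hj
          · exact hq
          · exact (Q j).smul_mem q (hrA j hj)
  classical
  obtain ⟨r, hr, hrQ⟩ := claim z.support
  refine hr (hV _ (fun j => ?_) (by rw [map_smul, hz, smul_zero]))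
  by_cases hj : j ∈ z.support
  · exact hrQ j hj
  · rw [DFinsupp.smul_apply, DFinsupp.notMem_support_iff.1 hj, smul_zero]
    exact zero_mem _

/-- A direct sum with compatible coordinate maps on `M` fills `M` if it is essential in `M` and
cyclic submodules of `M` are Noetherian. -/
lemma DFinsupp.surjective_lsum_of_essential (V : ∀ j, E j →ₗ[R] M) (h : ∀ j, M →ₗ[R] E j)
    (hV : ∀ (z : Π₀ j, E j) j, h j (DFinsupp.lsum ℕ V z) = z j)
    (hM : ∀ x : M, IsNoetherian R (Submodule.span R {x}))
    (hess : ∀ N : Submodule R M, N ≠ ⊥ → ∃ x ∈ N, x ∈ LinearMap.range (DFinsupp.lsum ℕ V) ∧ x ≠ 0) :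
    Function.Surjective (DFinsupp.lsum ℕ V) := by
  classical
  intro c
  set L := DFinsupp.lsum ℕ V with hL
  let D := Submodule.span R {c}
  have hD : IsNoetherian R D := hM c
  -- Finite generation confines the coordinates of all elements of D ∩ range L to a single finite
  -- set `F`, so that the sum defining `g` is finite.
  obtain ⟨s, hs⟩ : (D ⊓ LinearMap.range L).FG := by
    have := isNoetherian_submodule.1 hD (D ⊓ LinearMap.range L) inf_le_left
    exact this
  have hsr : ∀ x ∈ s, ∃ z, L z = x := fun x hx =>
    (hs ▸ Submodule.subset_span hx : x ∈ D ⊓ LinearMap.range L).2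
  choose! zf hzf using hsr
  let F := s.biUnion fun x => (zf x).support
  have hF : ∀ x ∈ D ⊓ LinearMap.range L, ∃ z, L z = x ∧ ∀ j ∉ F, z j = 0 := by
    intro x hx
    rw [← hs] at hx
    induction hx using Submodule.span_induction with
    | mem x hx =>
      refine ⟨zf x, hzf x hx, fun j hj => ?_⟩
      by_contra hne
      exact hj (Finset.mem_biUnion.2 ⟨x, hx, DFinsupp.mem_support_iff.2 hne⟩)
    | zero => exact ⟨0, map_zero _, fun _ _ => rfl⟩
    | add x y _ _ hx hy =>
      obtain ⟨a, rfl, ha⟩ := hx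
      obtain ⟨b, rfl, hb⟩ := hy
      exact ⟨a + b, map_add _ _ _, fun j hj => by simp [ha j hj, hb j hj]⟩
    | smul r x _ hx =>
      obtain ⟨a, rfl, ha⟩ := hx
      exact ⟨r • a, map_smul _ _ _, fun j hj => by simp [ha j hj]⟩
  let g : M →ₗ[R] M := ∑ j ∈ F, V j ∘ₗ h j
  have hg : ∀ x, g x = ∑ j ∈ F, V j (h j x) := fun x => by simp [g]
  have hgr : ∀ x, g x ∈ LinearMap.range L := by
    intro x
    rw [hg]
    refine Submodule.sum_mem _ fun j _ => ⟨DFinsupp.single j (h j x), ?_⟩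
    rw [hL, DFinsupp.lsum_single]
  have hgD : ∀ x ∈ D ⊓ LinearMap.range L, g x = x := by
    intro x hx
    obtain ⟨z, rfl, hz⟩ := hF x hx
    rw [hg]
    simp_rw [hV]
    rw [hL, DFinsupp.lsum_apply_apply, DFinsupp.sumAddHom_apply, DFinsupp.sum]
    refine (Finset.sum_subset (fun j hj => ?_) fun j _ hj => ?_).symm
    · by_contra hne
      exact DFinsupp.mem_support_iff.1 hj (hz j hne)
    · rw [DFinsupp.notMem_support_iff.1 hj, map_zero]
  -- If d - g(d) lies in the range of `L`, so does d, and then g(d) = d. So this image meets the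
  -- range only in zero, and essentiality makes it vanish.
  have hN : D.map (LinearMap.id - g) = ⊥ := by
    by_contra hne
    obtain ⟨_, ⟨d, hd, rfl⟩, hr, h0⟩ := hess _ hne
    apply h0
    have hd' : d ∈ LinearMap.range L := by
      have := add_mem hr (hgr d)
      simpa using this
    simp [hgD d ⟨hd, hd'⟩]
  have hc : (LinearMap.id - g : M →ₗ[R] M) c ∈ (⊥ : Submodule R M) :=
    hN ▸ Submodule.mem_map_of_mem (Submodule.mem_span_singleton_self c)
  rw [Submodule.mem_bot, LinearMap.sub_apply, LinearMap.id_apply, sub_eq_zero] at hc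
  rw [hc]
  exact hgr c

end ModuleSums

/-! ### C as the direct sum of the E(T_j) -/

namespace RightComodule

variable {k : Type u} {C : Type v} [Field k] [AddCommGroup C] [Module k C] [Coalgebra k C]

/-- A morphism of right comodules as a `C*`-linear map. -/
def IsHom.toDualAlgLinearMap {M N : Type*} [AddCommGroup M] [Module k M] [RightComodule k C M]
    [AddCommGroup N] [Module k N] [RightComodule k C N] {g : M →ₗ[k] N} (hg : IsHom k C g) :
    M →ₗ[DualAlg k C] N where
  toFun := g
  map_add' := map_add g
  map_smul' := (isHom_iff g).1 hg

lemma isNoetherian_span_singleton {M : Type*} [AddCommGroup M] [Module k M] [RightComodule k C M]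
    (x : M) : IsNoetherian (DualAlg k C) (Submodule.span (DualAlg k C) {x}) := by
  let Q := Submodule.span (DualAlg k C) {x}
  have : FiniteDimensional k (Q.restrictScalars k) :=
    finiteDimensional_span_singleton x
  have : IsNoetherian k Q := inferInstanceAs (IsNoetherian k (Q.restrictScalars k))
  exact isNoetherian_of_tower k this

variable {J : Type*} {T : J → RightSubcomodule k C C} {ET : J → Type v}
  [∀ j, AddCommGroup (ET j)] [∀ j, Module k (ET j)] [∀ j, RightComodule k C (ET j)]
  {ιT : ∀ j, (T j).toSubmodule →ₗ[k] ET j} {v : ∀ j, ET j →ₗ[k] C}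

/-- The direct sum of the injective envelopes of the summands `T j` of the socle is `C`. -/
lemma bijective_lsum [DecidableEq J] (hT : IsRightCoradicalDecomposition k C T)
    (hET : ∀ j, IsInjectiveEnvelope k C (ιT j)) (hv : ∀ j, IsHom k C (v j))
    (hvT : ∀ j t, v j (ιT j t) = t) :
    Function.Bijective (DFinsupp.lsum ℕ fun j => (hv j).toDualAlgLinearMap) := by
  classical
  set V := fun j => (hv j).toDualAlgLinearMap with hVdef
  have hV : ∀ j x, V j x = v j x := fun _ _ => rfl
  have inj : Function.Injective (DFinsupp.lsum ℕ V) := by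
    let Q : ∀ j, Submodule (DualAlg k C) (ET j) := fun j =>
      LinearMap.range (hET j).isHom.toDualAlgLinearMap
    refine DFinsupp.injective_lsum_of_essential V Q (fun j x hx => ?_) fun z hz h0 => ?_
    · by_contra! hne
      apply hx
      -- If no multiple of `x` were a nonzero element of the image of `T j`, the orbit of `x` would
      -- be a subcomodule meeting that image trivially.
      have : LinearMap.range (orbitMap (k := k) (C := C) x) = ⊥ := by
        refine (hET j).eq_bot_of_stable _ ?_ ?_
        · rintro f _ ⟨g, rfl⟩
          exact ⟨f * g, act_mul_apply f g x⟩
        · rintro t ⟨g, hg⟩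
          apply (hET j).injective
          rw [map_zero, ← hg]
          exact hne g ⟨t, hg.symm⟩
      have hx1 : x ∈ LinearMap.range (orbitMap (k := k) (C := C) x) := ⟨1, act_one_apply x⟩
      rw [this] at hx1
      exact hx1
    · choose t ht using hz
      ext j
      rw [DFinsupp.zero_apply]
      by_cases hj : j ∈ z.support
      · rw [DFinsupp.lsum_apply_apply, DFinsupp.sumAddHom_apply, DFinsupp.sum] at h0
        have ht' : ∀ j, v j (z j) = t j := fun j => by rw [← ht, ← hvT]; rfl
        have := (iSupIndep_iff_finsetSum_eq_zero_imp_eq_zero _).1 hT.independent z.support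
          (fun j => v j (z j)) (fun j _ => by rw [ht']; exact (t j).2) h0 j hj
        rw [ht'] at this
        rw [← ht, show t j = 0 from Subtype.ext this, map_zero]
      · exact DFinsupp.notMem_support_iff.1 hj
  refine ⟨inj, ?_⟩
  set L := DFinsupp.lsum ℕ V with hL
  let X := LinearMap.range L
  let X' : RightSubcomodule k C C := subcomoduleOfStable (X.restrictScalars k)
    fun f c hc => X.smul_mem f hc
  let e : (Π₀ j, ET j) ≃ₗ[DualAlg k C] X := LinearEquiv.ofInjective L inj
  -- Each coordinate of the sum extends to `C` separately, by injectivity of the one envelope `ET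
  -- j`; injectivity of the infinite direct sum is not needed.
  let h₀ : ∀ j, X'.toSubmodule →ₗ[k] ET j := fun j =>
    ((DFinsupp.lapply j : (Π₀ j, ET j) →ₗ[DualAlg k C] ET j) ∘ₗ
      e.symm.toLinearMap).restrictScalars k
  have hh₀ : ∀ j, IsHom k C (h₀ j) := by
    intro j
    rw [isHom_iff]
    rintro f ⟨x, hx⟩
    have : act f (⟨x, hx⟩ : X'.toSubmodule) = (f • (⟨x, hx⟩ : X) : X) :=
      Subtype.ext (coe_act f X' ⟨x, hx⟩)
    rw [this]
    exact map_smul ((DFinsupp.lapply j : (Π₀ j, ET j) →ₗ[DualAlg k C] ET j) ∘ₗ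
      e.symm.toLinearMap) f (⟨x, hx⟩ : X)
  have ext : ∀ j, ∃ h : C →ₗ[k] ET j, IsHom k C h ∧ h ∘ₗ X'.toSubmodule.subtype = h₀ j := fun j =>
    (hET j).isInjective _ _ _ _ ((isHom_iff _).2 fun f x => coe_act f X' x)
      X'.toSubmodule.injective_subtype (hh₀ j)
  choose h hh hhX using ext
  refine DFinsupp.surjective_lsum_of_essential V (fun j => (hh j).toDualAlgLinearMap) ?_
    isNoetherian_span_singleton ?_
  · intro z j
    have := LinearMap.congr_fun (hhX j) (e z)
    refine this.trans ?_
    change e.symm (e z) j = z j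
    rw [LinearEquiv.symm_apply_apply]
  · intro N hN
    obtain ⟨x, hx, hx', hx0⟩ := exists_mem_coradical (k := k) hN
    refine ⟨x, hx, ?_, hx0⟩
    have : coradical k C ≤ X.restrictScalars k := by
      rw [← hT.iSup_eq]
      refine iSup_le fun j t ht => ⟨DFinsupp.single j (ιT j ⟨t, ht⟩), ?_⟩
      rw [hL, DFinsupp.lsum_single]
      exact hvT j ⟨t, ht⟩
    exact this hx'

end RightComodule

/-! ### Independence, socles and length -/

lemma DFinsupp.iSupIndep_range_of_injective_lsum {R : Type*} [Ring R] {J : Type*} [DecidableEq J]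
    {E : J → Type*} [∀ j, AddCommGroup (E j)] [∀ j, Module R (E j)] {M : Type*} [AddCommGroup M]
    [Module R M] {V : ∀ j, E j →ₗ[R] M} (hV : Function.Injective (DFinsupp.lsum ℕ V)) :
    iSupIndep fun j => LinearMap.range (V j) := by
  rw [iSupIndep_iff_finsetSum_eq_zero_imp_eq_zero]
  intro s x hx h0 j hj
  choose! w hw using hx
  have hz : DFinsupp.lsum ℕ V (∑ j ∈ s, DFinsupp.single j (w j)) = 0 := by
    rw [map_sum, ← h0]
    refine Finset.sum_congr rfl fun j hj => ?_
    rw [DFinsupp.lsum_single, hw j hj]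
  have hz' := DFunLike.congr_fun (hV (hz.trans (map_zero _).symm)) j
  rw [DFinsupp.finsetSum_apply, Finset.sum_eq_single_of_mem j hj fun b _ hb =>
    DFinsupp.single_eq_of_ne hb.symm, DFinsupp.single_eq_same] at hz'
  rw [← hw j hj, hz', DFinsupp.zero_apply, map_zero]

/-- If the image is nonzero it contains the least nonzero submodule `Q`; the preimage of `Q` is then
nonzero, hence all of the simple module `S`. -/
lemma LinearMap.range_le_of_isSimpleModule {R S E : Type*} [Ring R] [AddCommGroup S] [Module R S]
    [AddCommGroup E] [Module R E] [IsSimpleModule R S] {Q : Submodule R E} (hQ0 : Q ≠ ⊥)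
    (hQ : ∀ N : Submodule R E, N = ⊥ ∨ Q ≤ N) (g : S →ₗ[R] E) : LinearMap.range g ≤ Q := by
  rcases hQ (LinearMap.range g) with h | h
  · rw [h]; exact bot_le
  · rcases eq_bot_or_eq_top (Q.comap g) with h' | h'
    · exact absurd (by rw [← Submodule.map_comap_eq_of_le h, h', Submodule.map_bot]) hQ0
    · rintro _ ⟨s, rfl⟩
      have : s ∈ Q.comap g := h' ▸ Submodule.mem_top
      exact this

/-- A finite product of simple modules has length equal to the number of factors, and length is
monotone under injections. -/
lemma Fintype.card_le_of_injective_pi_isSimpleModule {R : Type*} [Ring R] {F G : Type*} [Fintype F]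
    [Fintype G] {M : F → Type*} {N : G → Type*} [∀ i, AddCommGroup (M i)] [∀ i, Module R (M i)]
    [∀ j, AddCommGroup (N j)] [∀ j, Module R (N j)] [∀ i, IsSimpleModule R (M i)]
    [∀ j, IsSimpleModule R (N j)] (f : (∀ i, M i) →ₗ[R] ∀ j, N j) (hf : Function.Injective f) :
    Fintype.card F ≤ Fintype.card G := by
  have := Module.length_le_of_injective f hf
  simpa using this

namespace LeftComodule

variable {k : Type u} {C : Type v} [Field k] [AddCommGroup C] [Module k C] [Coalgebra k C]

/-- A morphism of left comodules as a `C*`-linear map. -/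
def IsHom.toDualAlgLinearMap {M N : Type*} [AddCommGroup M] [Module k M] [LeftComodule k C M]
    [AddCommGroup N] [Module k N] [LeftComodule k C N] {g : M →ₗ[k] N} (hg : IsHom k C g) :
    M →ₗ[(DualAlg k C)ᵐᵒᵖ] N where
  toFun := g
  map_add' := map_add g
  map_smul' f := (isHom_iff g).1 hg f.unop

lemma IsSimple.isSimpleModule {M : Type*} [AddCommGroup M] [Module k M] [LeftComodule k C M]
    (hM : IsSimple k C M) : IsSimpleModule (DualAlg k C)ᵐᵒᵖ M := by
  have := hM.1
  refine { eq_bot_or_eq_top := fun N => ?_ }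
  rcases hM.2 (subcomoduleOfStable (C := C) (N.restrictScalars k)
    fun f m hm => N.smul_mem (MulOpposite.op f) hm) with h | h
  · exact Or.inl ((Submodule.restrictScalars_eq_bot_iff k _ M).1 h)
  · exact Or.inr ((Submodule.restrictScalars_eq_top_iff k _ M).1 h)

end LeftComodule

/-! ### The pairings coming from θ -/

section CoFrobenius

variable {k : Type u} {C : Type v} [Field k] [AddCommGroup C] [Module k C] [Coalgebra k C]
variable {θ : C →ₗ[k] DualAlg k C}

lemma balanced_of_map_smul (hθ : ∀ (c : C) (f : DualAlg k C), θ (MulOpposite.op f • c) = θ c * f)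
    (f : DualAlg k C) (c d : C) :
    (θ (LeftComodule.act f c)).ofConv d = (θ c).ofConv (RightComodule.act f d) := by
  rw [← convMul_apply_right, ← hθ]
  rfl

/-- The map `E → Y*` induced by `θ : C → C*` and maps `u : E → C`, `v : Y → C`. -/
def dualPairing (θ : C →ₗ[k] DualAlg k C) {E Y : Type*} [AddCommGroup E] [Module k E]
    [AddCommGroup Y] [Module k Y] (u : E →ₗ[k] C) (v : Y →ₗ[k] C) : E →ₗ[k] Y →ₗ[k] k :=
  LinearMap.lcomp k k v ∘ₗ (WithConv.linearEquiv k (C →ₗ[k] k)).toLinearMap ∘ₗ θ ∘ₗ u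

omit [Coalgebra k C] in
lemma dualPairing_apply {E Y : Type*} [AddCommGroup E] [Module k E]
    [AddCommGroup Y] [Module k Y] (u : E →ₗ[k] C) (v : Y →ₗ[k] C) (m : E) (y : Y) :
    dualPairing θ u v m y = (θ (u m)).ofConv (v y) := rfl

lemma dualPairing_act (hθ : ∀ (c : C) (f : DualAlg k C), θ (MulOpposite.op f • c) = θ c * f)
    {E Y : Type*} [AddCommGroup E] [Module k E] [LeftComodule k C E]
    [AddCommGroup Y] [Module k Y] [RightComodule k C Y] {u : E →ₗ[k] C} {v : Y →ₗ[k] C}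
    (hu : LeftComodule.IsHom k C u) (hv : RightComodule.IsHom k C v) (f : DualAlg k C)
    (m : E) (y : Y) : dualPairing θ u v (LeftComodule.act f m) y =
      dualPairing θ u v m (RightComodule.act f y) := by
  rw [dualPairing_apply, dualPairing_apply, (LeftComodule.isHom_iff u).1 hu,
    (RightComodule.isHom_iff v).1 hv, balanced_of_map_smul hθ]

/-- `dualPairing` as a map of right `C*`-modules. -/
def dualPairingLinearMap
    (hθ : ∀ (c : C) (f : DualAlg k C), θ (MulOpposite.op f • c) = θ c * f)
    {E Y : Type*} [AddCommGroup E] [Module k E] [LeftComodule k C E]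
    [AddCommGroup Y] [Module k Y] [RightComodule k C Y] {u : E →ₗ[k] C} {v : Y →ₗ[k] C}
    (hu : LeftComodule.IsHom k C u) (hv : RightComodule.IsHom k C v) :
    E →ₗ[(DualAlg k C)ᵐᵒᵖ] (Y →ₗ[k] k) where
  toFun := dualPairing θ u v
  map_add' := map_add _
  map_smul' f m := by
    ext y
    exact dualPairing_act hθ hu hv f.unop m y

/-- The kernel of `p` is stable, so `p` kills every translate of `z`, and by associativity these
translates compute the functionals of the element in question. -/
lemma act_toConv_comp_eq_zero {E : Type*} [AddCommGroup E] [Module k E] [LeftComodule k C E]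
    {p : C →ₗ[k] E} (hp : LeftComodule.IsHom k C p) {z : C} (hz : p z = 0) (α : E →ₗ[k] k) :
    RightComodule.act (WithConv.toConv (α ∘ₗ p)) z = 0 := by
  apply eq_of_forall_dual_apply (k := k)
  intro φ
  rw [← convMul_apply_right, convMul_apply_left]
  change α (p _) = _
  rw [(LeftComodule.isHom_iff p).1 hp, hz]
  simp

/-- Elements of the independent `Y j` that represent ε ∘ u under θ have linearly independent images
under `p` in the finite-dimensional `E`. -/
lemma finite_setOf_exists_counit
    (hθ : ∀ (c : C) (f : DualAlg k C), θ (MulOpposite.op f • c) = θ c * f)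
    {E : Type*} [AddCommGroup E] [Module k E] [LeftComodule k C E] [Nontrivial E]
    [FiniteDimensional k E] {u : E →ₗ[k] C} {p : C →ₗ[k] E} (hu : LeftComodule.IsHom k C u)
    (hp : LeftComodule.IsHom k C p) (hpu : ∀ m, p (u m) = m)
    {J : Type*} {Y : J → Submodule (DualAlg k C) C} (hY : iSupIndep Y) (P : J → Prop)
    (hP : ∀ j, P j → ∃ y ∈ Y j, ∀ m, (θ (u m)).ofConv y = Coalgebra.counit (R := k) (u m)) :
    {j | P j}.Finite := by
  choose z hzY hz using fun j : {j // P j} => hP j j.2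
  have hY' : iSupIndep fun j : {j // P j} => Y j := hY.comp Subtype.val_injective
  have li : LinearIndependent k fun j => p (z j) := by
    rw [linearIndependent_iff']
    intro s g hg j hj
    obtain ⟨m, hm⟩ := exists_ne (0 : E)
    obtain ⟨α, hα⟩ := Module.Projective.exists_dual_eq_one k hm
    -- Acting by α ∘ p turns a relation among the p(z_j) into a relation in `C` itself, where
    -- independence of the `Y j` separates the terms. Pairing the j-th term with `m` then returns
    -- its coefficient, since α(m) = 1.
    let f : DualAlg k C := WithConv.toConv (α ∘ₗ p)
    have hsum : ∑ i ∈ s, RightComodule.act f (g i • z i) = 0 := by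
      rw [← map_sum]
      refine act_toConv_comp_eq_zero hp ?_ α
      rw [← hg, map_sum]
      exact Finset.sum_congr rfl fun i _ => map_smul _ _ _
    have h0 := (iSupIndep_iff_finsetSum_eq_zero_imp_eq_zero _).1 hY' s
      (fun i => RightComodule.act f (g i • z i))
      (fun i _ => (Y i).smul_mem f ((Y i).smul_of_tower_mem (g i) (hzY i))) hsum j hj
    have h1 : (θ (u m)).ofConv (RightComodule.act f (g j • z j)) = g j := by
      rw [map_smul, map_smul, ← balanced_of_map_smul hθ, ← (LeftComodule.isHom_iff u).1 hu, hz,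
        (LeftComodule.isHom_iff u).1 hu, counit_act_left]
      change g j • α (p (u m)) = _
      rw [hpu, hα, smul_eq_mul, mul_one]
    rw [← h1, h0, map_zero]
  have : Finite {j // P j} := li.finite
  exact Set.finite_coe_iff.1 this

/-- Hall's inequality. An element of the sum of the S_i, i ∈ F, is determined by its pairings with
the E(T_j), j ∈ G, and each pairing takes values in a copy of some E(S_a), where it lands in the
simple socle. -/
lemma card_le_card_of_linked (hθinj : Function.Injective θ)
    (hθ : ∀ (c : C) (f : DualAlg k C), θ (MulOpposite.op f • c) = θ c * f)
    {I J : Type*} {S : I → LeftSubcomodule k C C}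
    (hSsimple : ∀ i, LeftComodule.IsSimple k C (S i).toSubmodule)
    (hSindep : iSupIndep fun i => (S i).toSubmodule)
    {ES : I → Type v} [∀ i, AddCommGroup (ES i)] [∀ i, Module k (ES i)]
    [∀ i, LeftComodule k C (ES i)] {ιS : ∀ i, (S i).toSubmodule →ₗ[k] ES i}
    (hES : ∀ i, LeftComodule.IsInjectiveEnvelope k C (ιS i))
    {ET : J → Type v} [∀ j, AddCommGroup (ET j)] [∀ j, Module k (ET j)]
    [∀ j, RightComodule k C (ET j)]
    {u : ∀ i, ES i →ₗ[k] C} {v : ∀ j, ET j →ₗ[k] C}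
    (hu : ∀ i, LeftComodule.IsHom k C (u i)) (hv : ∀ j, RightComodule.IsHom k C (v j))
    (hvtop : ∀ g : C →ₗ[k] k, (∀ j, g ∘ₗ v j = 0) → g = 0)
    (F : Finset I) (G : Finset J)
    (hG : ∀ i ∈ F, ∀ j ∉ G, ∀ s ∈ (S i).toSubmodule, ∀ y, (θ s).ofConv (v j y) = 0)
    (hbij : ∀ j ∈ G, ∃ i, Function.Bijective (dualPairing θ (u i) (v j))) :
    F.card ≤ G.card := by
  choose a ha using fun j : G => hbij j j.2
  let A := (DualAlg k C)ᵐᵒᵖ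
  let B : ∀ j : G, ES (a j) ≃ₗ[A] (ET j →ₗ[k] k) := fun j =>
    LinearEquiv.ofBijective (dualPairingLinearMap hθ (hu (a j)) (hv j)) (ha j)
  have hid : LeftComodule.IsHom k C (LinearMap.id : C →ₗ[k] C) :=
    (LeftComodule.isHom_iff _).2 fun _ _ => rfl
  -- Restriction of θ(c) to E(T_j), transported along the identification of E(T_j)* with the
  -- envelope of a simple left comodule.
  let W : ∀ j : G, C →ₗ[A] ES (a j) := fun j =>
    (B j).symm.toLinearMap ∘ₗ dualPairingLinearMap hθ hid (hv j)
  let inc : ∀ i : F, (S i).toSubmodule →ₗ[A] C := fun i =>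
    LeftComodule.IsHom.toDualAlgLinearMap
      ((LeftComodule.isHom_iff (S i).toSubmodule.subtype).2 fun f m =>
        LeftComodule.coe_act f (S i) m)
  let sum : (∀ i : F, (S i).toSubmodule) →ₗ[A] C := ∑ i, inc i ∘ₗ LinearMap.proj i
  have hsum : ∀ s, sum s = ∑ i, (s i : C) := fun s => by
    simp only [sum, LinearMap.sum_apply]; rfl
  have hsimple : ∀ i, IsSimpleModule A (S i).toSubmodule := fun i => (hSsimple i).isSimpleModule
  let ι' : ∀ i, (S i).toSubmodule →ₗ[A] ES i := fun i => (hES i).isHom.toDualAlgLinearMap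
  let Q : ∀ i, Submodule A (ES i) := fun i => LinearMap.range (ι' i)
  have eQ : ∀ i, (S i).toSubmodule ≃ₗ[A] Q i := fun i =>
    LinearEquiv.ofInjective (ι' i) (hES i).injective
  have hQsimple : ∀ i, IsSimpleModule A (Q i) := fun i => IsSimpleModule.congr (eQ i).symm
  have hQ0 : ∀ i, Q i ≠ ⊥ := fun i => Submodule.nontrivial_iff_ne_bot.1
    (IsSimpleModule.nontrivial A (Q i))
  have hQ : ∀ i (N : Submodule A (ES i)), N = ⊥ ∨ Q i ≤ N := by
    intro i N
    rcases LeftComodule.stable_eq_bot_or (hSsimple i) (hES i) (N.restrictScalars k)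
      (fun f m hm => N.smul_mem (MulOpposite.op f) hm) with h | h
    · exact Or.inl ((Submodule.restrictScalars_eq_bot_iff k _ _).1 h)
    · exact Or.inr h
  have hW : ∀ (j : G) s, W j (sum s) ∈ Q (a j) := by
    intro j s
    rw [hsum, map_sum]
    exact Submodule.sum_mem _ fun i _ => LinearMap.range_le_of_isSimpleModule (hQ0 (a j))
      (hQ (a j)) (W j ∘ₗ inc i) ⟨s i, rfl⟩
  let Ψ : (∀ i : F, (S i).toSubmodule) →ₗ[A] ∀ j : G, Q (a j) :=
    LinearMap.pi fun j => LinearMap.codRestrict (Q (a j)) (W j ∘ₗ sum) (hW j)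
  have inj : Function.Injective Ψ := by
    rw [injective_iff_map_eq_zero]
    intro s hs
    have h1 : ∀ j : G, dualPairing θ LinearMap.id (v j) (sum s) = 0 := by
      intro j
      have : W j (sum s) = 0 := congrArg Subtype.val (congrFun hs j)
      exact (B j).symm.map_eq_zero_iff.1 this
    -- The functional θ(sum s) vanishes on E(T_j) by assumption for j ∈ G, and by `hG` for the other
    -- j; the E(T_j) together span `C`.
    have h2 : (θ (sum s)).ofConv = 0 := by
      apply hvtop
      intro j
      by_cases hj : j ∈ G
      · exact h1 ⟨j, hj⟩
      · change dualPairing θ LinearMap.id (v j) (sum s) = 0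
        rw [hsum, map_sum]
        refine Finset.sum_eq_zero fun i _ => ?_
        ext y
        exact hG i i.2 j hj _ (s i).2 y
    have h3 : sum s = 0 := hθinj (by rw [map_zero]; exact WithConv.ext h2)
    rw [hsum] at h3
    have hind : iSupIndep fun i : F => (S i).toSubmodule := hSindep.comp Subtype.val_injective
    funext i
    exact Subtype.ext ((iSupIndep_iff_finsetSum_eq_zero_imp_eq_zero _).1 hind Finset.univ
      (fun i => (s i : C)) (fun i _ => (s i).2) h3 i (Finset.mem_univ i))
  simpa using Fintype.card_le_of_injective_pi_isSimpleModule (R := A)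
    (M := fun i : F => (S i).toSubmodule) (N := fun j : G => Q (a j)) Ψ inj

end CoFrobenius

/-! ### Matching by Hall's theorem -/

theorem mainTheorem4 (k : Type u) (C : Type v) [Field k] [AddCommGroup C] [Module k C]
    [Coalgebra k C] (hC : IsRightCoFrobenius k C)
    {I J : Type*} (S : I → LeftSubcomodule k C C) (T : J → RightSubcomodule k C C)
    (hS : IsLeftCoradicalDecomposition k C S) (hT : IsRightCoradicalDecomposition k C T)
    (ES : I → Type v) [∀ i, AddCommGroup (ES i)] [∀ i, Module k (ES i)]
    [∀ i, LeftComodule k C (ES i)]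
    (ιS : ∀ i, (S i).toSubmodule →ₗ[k] ES i)
    (hES : ∀ i, LeftComodule.IsInjectiveEnvelope k C (ιS i))
    (ET : J → Type v) [∀ j, AddCommGroup (ET j)] [∀ j, Module k (ET j)]
    [∀ j, RightComodule k C (ET j)]
    (ιT : ∀ j, (T j).toSubmodule →ₗ[k] ET j)
    (hET : ∀ j, RightComodule.IsInjectiveEnvelope k C (ιT j)) :
    ∃ φ : I → J, Function.Injective φ ∧
      ∀ i, Nonempty (ES i ≃ₗ[(DualAlg k C)ᵐᵒᵖ] (ET (φ i) →ₗ[k] k)) := by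
  classical
  obtain ⟨θ, hθinj, hθ⟩ := hC
  choose u p hu hp huS hpu using fun i => LeftComodule.exists_hom_retraction (hES i)
  choose v hv hvT using fun j => RightComodule.exists_hom (hET j).isHom (hET j).injective
  obtain ⟨Linj, Lsurj⟩ := RightComodule.bijective_lsum hT hET hv hvT
  have hvtop : ∀ g : C →ₗ[k] k, (∀ j, g ∘ₗ v j = 0) → g = 0 := by
    intro g hg
    ext c
    obtain ⟨z, rfl⟩ := Lsurj c
    rw [DFinsupp.lsum_apply_apply, DFinsupp.sumAddHom_apply, DFinsupp.sum, map_sum]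
    exact Finset.sum_eq_zero fun j _ => LinearMap.congr_fun (hg j) (z j)
  -- Nonvanishing is required on S_i itself, not merely on E(S_i): the kernel of the pairing then
  -- misses the socle and so is zero. Absence of links is also what `card_le_card_of_linked` needs
  -- outside `G`.
  let Linked : I → J → Prop := fun i j =>
    ∃ (s : (S i).toSubmodule) (y : ET j), (θ s).ofConv (v j y) ≠ 0
  have key : ∀ i j, Linked i j → FiniteDimensional k (ES i) ∧
      Function.Bijective (dualPairing θ (u i) (v j)) ∧
      ∃ y₀, ∀ m, dualPairing θ (u i) (v j) m y₀ = Coalgebra.counit (R := k) (u i m) := by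
    rintro i j ⟨s, y, h⟩
    refine bijective_of_balanced (hS.isSimple i) (hES i) (hT.isSimple j) (hET j) _
      (dualPairing_act hθ (hu i) (hv j)) (hu i) (hp i) (hpu i) (s := s) (y := y) ?_
    rwa [dualPairing_apply, huS]
  have hfin : ∀ i, {j | Linked i j}.Finite := by
    intro i
    rcases Set.eq_empty_or_nonempty {j | Linked i j} with h | ⟨j, hj⟩
    · rw [h]; exact Set.finite_empty
    · have := (key i j hj).1
      have := (hS.isSimple i).1
      have : Nontrivial (ES i) := (hES i).injective.nontrivial
      refine finite_setOf_exists_counit hθ (hu i) (hp i) (hpu i)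
        (DFinsupp.iSupIndep_range_of_injective_lsum Linj) _ fun j hj => ?_
      obtain ⟨y₀, hy₀⟩ := (key i j hj).2.2
      exact ⟨v j y₀, ⟨y₀, rfl⟩, hy₀⟩
  -- Hall's theorem for the finite partner sets. Taking `F` to be a singleton, the inequality
  -- includes the fact that every i has at least one partner.
  obtain ⟨φ, hφ, hφt⟩ := (Finset.all_card_le_biUnion_card_iff_exists_injective
    fun i => (hfin i).toFinset).1 fun F => by
      refine card_le_card_of_linked hθinj hθ hS.isSimple hS.independent hES hu hv hvtop F _
        (fun i hi j hj s hs y => ?_) fun j hj => ?_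
      · by_contra h
        exact hj (Finset.mem_biUnion.2 ⟨i, hi, (hfin i).mem_toFinset.2 ⟨⟨s, hs⟩, y, h⟩⟩)
      · obtain ⟨i, _, hi⟩ := Finset.mem_biUnion.1 hj
        exact ⟨i, (key i j ((hfin i).mem_toFinset.1 hi)).2.1⟩
  exact ⟨φ, hφ, fun i => ⟨LinearEquiv.ofBijective (dualPairingLinearMap hθ (hu i) (hv (φ i)))
    (key i _ ((hfin i).mem_toFinset.1 (hφt i))).2.1⟩⟩
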